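/- Let $-\infty\le a<b\le+\infty$ and let $f$ be an area-preserving diffeomorphism of class $C^1$ of the cylinder $({\mathbb R}/{\mathbb Z})\times(a,b)$, isotopic to the identity, with a lift $F=(F_1,F_2)$ to the strip ${\mathbb R}\times(a,b)$ satisfying the twist condition $\partial F_1/\partial y>0$. If $a$ (resp. $b$) is finite, assume that $F$ extends continuously to the boundary of the strip by $F(x,a)=(x+\omega_-,a)$ (resp. $F(x,b)=(x+\omega_+,b)$) with $\omega_\pm\in{\mathbb R}$; if $a=-\infty$ (resp. $b=+\infty$), let $\omega_-$ (resp. $\omega_+$) be the limit of $F_1(x,y)-x$ as $y\to a$ (resp. $y\to b$), which may be infinite and is assumed not to depend on $x$. The interval $(\omega_-,\omega_+)$ is the twist interval. Let $H$ be a real function on $D=\{(x,x')\in{\mathbb R}^2\mid\omega_-<x'-x<\omega_+\}$ with $H(x+k,x'+k)=H(x,x')$ for $k\in{\mathbb Z}$ which generates $F$: $F(x,y)=(x',y')$ if and only if $(x,x')\in D$, $\frac{\partial H}{\partial x}(x,x')=-y$ and $\frac{\partial H}{\partial x'}(x,x')=y'$. Extend $H$ to all of ${\mathbb R}^2$ by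 its lower limit from inside $D$ at the points of $\partial D$ (the continuous extension where there is one) and by $+\infty$ outside $\overline D$. For $p\in{\mathbb Z}$ and $r\ge1$ let $T_{p,r}$ be the infimum of $H(x_0,x_1)+H(x_1,x_2)+\dots+H(x_{r-1},x_r)$ over all sequences $(x_n)_{n\in{\mathbb Z}}$ of real numbers with $x_{n+r}=x_n+p$ for all $n$ that are nondecreasing if $p\ge0$ and nonincreasing if $p\le0$. Then for all relatively prime $p\in{\mathbb Z}$, $q\in{\mathbb Z}_+$ with $\frac pq\in(\omega_-,\omega_+)$ and $q\ne1$, $$T_{p,q-1}+T_{p,q+1}>2\,T_{p,q}.$$ Moreover, for each $r\in\{q-1,q,q+1\}$ with $\frac pr\in(\omega_-,\omega_+)$, in particular for $r=q$, the value $T_{p,r}$ is finite and is attained at a sequence with $\omega_-<x_{n+1}-x_n<\omega_+$ for all $n$. -/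

import Mathlib

open Filter Topology

noncomputable section

namespace MonotoneTwist

/-- The open strip `ℝ × (a, b)`, the universal cover of the cylinder `(ℝ/ℤ) × (a, b)`, where
`-∞ ≤ a < b ≤ +∞`. -/
def strip (a b : EReal) : Set (ℝ × ℝ) :=
  {z | a < (z.2 : EReal) ∧ (z.2 : EReal) < b}

/-- `F` is a lift to `ℝ × (a, b)` of a monotone twist map of the cylinder `(ℝ/ℤ) × (a, b)` with
twist interval `(ωm, ωp)`.

The map `f` of the cylinder is a diffeomorphism because `F` is a `C¹` bijection of the strip with
invertible derivative which commutes with the unit translation; it is area preserving and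
orientation preserving because the Jacobian determinant is `1`. Orientation preservation, together
with `F (x + 1, y) = F (x, y) + (1, 0)`, is what isotopy of `f` to the identity amounts to.

At a finite end of `(a, b)` the map `F` extends continuously to the boundary line as a rigid shift
by the corresponding endpoint of the twist interval. At an infinite end this endpoint is the limit
of the displacement `F₁ (x, y) - x`, which may be infinite. -/
structure IsTwistMap (a b ωm ωp : EReal) (F : ℝ × ℝ → ℝ × ℝ) : Prop where
  lt : a < b
  contDiffOn : ContDiffOn ℝ 1 F (strip a b)
  bijOn : Set.BijOn F (strip a b) (strip a b)
  translate : ∀ x y : ℝ, (x, y) ∈ strip a b →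
    F (x + 1, y) = ((F (x, y)).1 + 1, (F (x, y)).2)
  area : ∀ z ∈ strip a b, (fderiv ℝ F z).det = 1
  twist : ∀ x y : ℝ, (x, y) ∈ strip a b → 0 < deriv (fun s : ℝ => (F (x, s)).1) y
  lower_finite : ∀ a₀ : ℝ, a = (a₀ : EReal) → ∃ w : ℝ, ωm = (w : EReal) ∧
    ∀ x : ℝ, Tendsto F (𝓝[strip a b] (x, a₀)) (𝓝 (x + w, a₀))
  upper_finite : ∀ b₀ : ℝ, b = (b₀ : EReal) → ∃ w : ℝ, ωp = (w : EReal) ∧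
    ∀ x : ℝ, Tendsto F (𝓝[strip a b] (x, b₀)) (𝓝 (x + w, b₀))
  lower_infinite : a = ⊥ → ∀ x : ℝ,
    Tendsto (fun y : ℝ => (((F (x, y)).1 - x : ℝ) : EReal)) atBot (𝓝 ωm)
  upper_infinite : b = ⊤ → ∀ x : ℝ,
    Tendsto (fun y : ℝ => (((F (x, y)).1 - x : ℝ) : EReal)) atTop (𝓝 ωp)

/-- The domain `{(x, x') | ωm < x' - x < ωp}` of a generating function. -/
def genDomain (ωm ωp : EReal) : Set (ℝ × ℝ) :=
  {z | ωm < ((z.2 - z.1 : ℝ) : EReal) ∧ ((z.2 - z.1 : ℝ) : EReal) < ωp}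

/-- `H` is a generating function of `F`: it is periodic in the diagonal direction, and
`F (x, y) = (x', y')` if and only if `∂H/∂x (x, x') = -y` and `∂H/∂x' (x, x') = y'`.
Only the values of `H` on `genDomain ωm ωp` matter. -/
structure IsGeneratingFunction (a b ωm ωp : EReal) (F : ℝ × ℝ → ℝ × ℝ) (H : ℝ → ℝ → ℝ) :
    Prop where
  periodic : ∀ (x x' : ℝ) (k : ℤ), (x, x') ∈ genDomain ωm ωp → H (x + k) (x' + k) = H x x'
  generates : ∀ x y x' y' : ℝ, (x, y) ∈ strip a b →
    (F (x, y) = (x', y') ↔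
      (x, x') ∈ genDomain ωm ωp ∧
        HasDerivAt (fun s : ℝ => H s x') (-y) x ∧ HasDerivAt (fun s : ℝ => H x s) y' x')

/-- The extension of `H` from `genDomain ωm ωp` to all pairs: it is `H` on the (open) domain,
the limit inferior of `H` from inside the domain at its boundary points `x' - x = ωm`,
`x' - x = ωp` (this is the continuous extension wherever there is one), and `+∞` elsewhere, where
the filter below is trivial. -/
def extend (ωm ωp : EReal) (H : ℝ → ℝ → ℝ) (x x' : ℝ) : EReal :=
  liminf (fun w : ℝ × ℝ => (H w.1 w.2 : EReal)) (𝓝[genDomain ωm ωp] (x, x'))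

/-- The bi-infinite sequences with `x (n + q) = x n + p` which are monotone: nondecreasing, or
nonincreasing in the mirror case of negative `p`. -/
def periodicSeqs (p : ℤ) (q : ℕ) : Set (ℤ → ℝ) :=
  {x | (∀ n : ℤ, x (n + q) = x n + p) ∧ (0 ≤ p → Monotone x) ∧ (p ≤ 0 → Antitone x)}

/-- The action `H (x₀, x₁) + H (x₁, x₂) + ⋯ + H (x_{q-1}, x_q)`, equal to `+∞` when some pair
lies outside the closure of the domain of `H`. -/
def action (ωm ωp : EReal) (H : ℝ → ℝ → ℝ) (q : ℕ) (x : ℤ → ℝ) : EReal :=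
  ∑ n ∈ Finset.range q, extend ωm ωp H (x (n : ℤ)) (x ((n : ℤ) + 1))

/-- The minimal action `T_{p,q}` of a `(p, q)`-periodic sequence. -/
def minAction (ωm ωp : EReal) (H : ℝ → ℝ → ℝ) (p : ℤ) (q : ℕ) : EReal :=
  sInf (action ωm ωp H q '' periodicSeqs p q)

end MonotoneTwist

end

namespace MonotoneTwist

/-! Write `Y` and `Z` for the heights of a point and of its image as functions of `(x, x')`, so that
`∂H/∂x = -Y` and `∂H/∂x' = Z`. The twist makes `Y` increase in `x'`, which integrates to the
crossing inequality `H x x' + H u u' < H x u' + H u x'` for `x < u`, `x' < u'` (`cross_lt`). It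
survives, still strict, for finite boundary values (`cross_lt_extend`).

Let `p > 0`; negative `p` follows by reflection, and `p = 0` is excluded by coprimality. Take
minimizers `x`, `z` of periods `q - 1`, `q + 1`. As `x` advances faster, after a shift `x 0 ≤ z 0 ≤
z 1 ≤ x 1` (`exists_nested`). Exchanging the ends of these two steps does not increase the action,
and regroups the `2q` steps into two chains of `q` steps, each ending where the other starts, up to
`p`. Their pointwise maximum and minimum are `(p, q)`-periodic and do not increase the total
(`exists_max_min`), whence the weak inequality. In case of equality both are minimizers and the
chains touch, so they coincide (`eq_of_touch`); strict monotonicity then makes the initial exchange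
strict, a contradiction.

Minimizers exist by compactness (`exists_isActionMin`). Their steps are interior because near an
extremal step the height tends to the end of `(a, b)`, so moving one term lowers the action
(`exists_lt_of_upper`, `isActionMin_mem_genDomain`). -/

lemma isOpen_strip (a b : EReal) : IsOpen (strip a b) :=
  (isOpen_lt continuous_const (continuous_coe_real_ereal.comp continuous_snd)).inter
    (isOpen_lt (continuous_coe_real_ereal.comp continuous_snd) continuous_const)

lemma isOpen_genDomain (ωm ωp : EReal) : IsOpen (genDomain ωm ωp) :=
  (isOpen_lt continuous_const
    (continuous_coe_real_ereal.comp (continuous_snd.sub continuous_fst))).inter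
    (isOpen_lt (continuous_coe_real_ereal.comp (continuous_snd.sub continuous_fst))
      continuous_const)

lemma genDomain_of_le {ωm ωp : EReal} {z₁ z₂ : ℝ × ℝ} {s s' : ℝ} (h₁ : z₁ ∈ genDomain ωm ωp)
    (h₂ : z₂ ∈ genDomain ωm ωp) (hl : z₁.2 - z₁.1 ≤ s' - s) (hu : s' - s ≤ z₂.2 - z₂.1) :
    (s, s') ∈ genDomain ωm ωp :=
  ⟨h₁.1.trans_le (EReal.coe_le_coe_iff.2 hl), (EReal.coe_le_coe_iff.2 hu).trans_lt h₂.2⟩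

/-! ### One-sided derivative signs and the interior crossing inequality. -/

lemma nonpos_of_hasDerivAt_of_le_left {f : ℝ → ℝ} {c t δ : ℝ} (hf : HasDerivAt f c t)
    (hδ : 0 < δ) (h : ∀ s, t - δ < s → s < t → f t ≤ f s) : c ≤ 0 := by
  have h1 : Tendsto (slope f t) (𝓝[<] t) (𝓝 c) :=
    (hasDerivAt_iff_tendsto_slope.1 hf).mono_left
      (nhdsWithin_mono _ fun s (hs : s < t) => hs.ne)
  refine le_of_tendsto h1 ?_
  have h2 : ∀ᶠ s in 𝓝[<] t, t - δ < s :=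
    nhdsWithin_le_nhds (lt_mem_nhds (by linarith))
  filter_upwards [h2, self_mem_nhdsWithin] with s hs hst
  rw [slope_def_field]
  exact div_nonpos_of_nonneg_of_nonpos (sub_nonneg.2 (h s hs hst)) (sub_nonpos.2 (le_of_lt hst))

lemma nonneg_of_hasDerivAt_of_le_right {f : ℝ → ℝ} {c t δ : ℝ} (hf : HasDerivAt f c t)
    (hδ : 0 < δ) (h : ∀ s, t < s → s < t + δ → f t ≤ f s) : 0 ≤ c := by
  have h1 : Tendsto (slope f t) (𝓝[>] t) (𝓝 c) :=
    (hasDerivAt_iff_tendsto_slope.1 hf).mono_left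
      (nhdsWithin_mono _ fun s (hs : t < s) => hs.ne')
  refine ge_of_tendsto h1 ?_
  have h2 : ∀ᶠ s in 𝓝[>] t, s < t + δ :=
    nhdsWithin_le_nhds (gt_mem_nhds (by linarith))
  filter_upwards [h2, self_mem_nhdsWithin] with s hs hst
  rw [slope_def_field]
  exact div_nonneg (sub_nonneg.2 (h s hst hs)) (sub_nonneg.2 (le_of_lt hst))

/-- The difference `H s x' - H s u'` has derivative `Y s u' - Y s x' > 0` on `[x, u]`. All
displacements involved lie between `x' - u` and `u' - x`, so the two given corners keep the whole
rectangle in the domain. No second derivative of `H` is needed. -/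
lemma cross_lt {ωm ωp : EReal} {H Y : ℝ → ℝ → ℝ}
    (hd : ∀ x x', (x, x') ∈ genDomain ωm ωp → HasDerivAt (fun s => H s x') (-Y x x') x)
    (hY : ∀ x x' x'', (x, x') ∈ genDomain ωm ωp → (x, x'') ∈ genDomain ωm ωp → x' < x'' →
      Y x x' < Y x x'')
    {x u x' u' : ℝ} (hx : x < u) (hx' : x' < u') (h₁ : (x, u') ∈ genDomain ωm ωp)
    (h₂ : (u, x') ∈ genDomain ωm ωp) : H x x' + H u u' < H x u' + H u x' := by
  have hmem : ∀ s ∈ Set.Icc x u, (s, x') ∈ genDomain ωm ωp ∧ (s, u') ∈ genDomain ωm ωp := by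
    intro s hs
    exact ⟨genDomain_of_le h₂ h₁ (by simp; linarith [hs.2]) (by simp; linarith [hs.1]),
      genDomain_of_le h₂ h₁ (by simp; linarith [hs.2]) (by simp; linarith [hs.1])⟩
  have hder : ∀ s ∈ Set.Icc x u, HasDerivAt (fun s => H s x' - H s u') (-Y s x' - -Y s u') s :=
    fun s hs => (hd s x' (hmem s hs).1).sub (hd s u' (hmem s hs).2)
  have hmono : StrictMonoOn (fun s => H s x' - H s u') (Set.Icc x u) := by
    refine strictMonoOn_of_deriv_pos (convex_Icc x u)
      (fun s hs => (hder s hs).continuousAt.continuousWithinAt) ?_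
    intro s hs
    rw [interior_Icc] at hs
    have hs' := Set.Ioo_subset_Icc_self hs
    rw [(hder s hs').deriv]
    linarith [hY s x' u' (hmem s hs').1 (hmem s hs').2 hx']
  have := hmono (Set.left_mem_Icc.2 hx.le) (Set.right_mem_Icc.2 hx.le) hx
  simp only at this
  linarith

/-- A generating function `H` of a monotone twist map, with `∂H/∂x = -Y` and `∂H/∂x' = Z`. -/
structure IsTwistPotential (a b ωm ωp : EReal) (H Y Z : ℝ → ℝ → ℝ) : Prop where
  periodic : ∀ (x x' : ℝ) (k : ℤ), (x, x') ∈ genDomain ωm ωp → H (x + k) (x' + k) = H x x'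
  deriv_fst : ∀ x x', (x, x') ∈ genDomain ωm ωp → HasDerivAt (fun s => H s x') (-Y x x') x
  deriv_snd : ∀ x x', (x, x') ∈ genDomain ωm ωp → HasDerivAt (fun s => H x s) (Z x x') x'
  strictMono : ∀ x x' x'', (x, x') ∈ genDomain ωm ωp → (x, x'') ∈ genDomain ωm ωp → x' < x'' →
    Y x x' < Y x x''
  strictAnti : ∀ x₁ x₂ x', (x₁, x') ∈ genDomain ωm ωp → (x₂, x') ∈ genDomain ωm ωp → x₁ < x₂ →
    Z x₂ x' < Z x₁ x'
  continuousOn_fst : ContinuousOn (fun z : ℝ × ℝ => Y z.1 z.2) (genDomain ωm ωp)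
  continuousOn_snd : ContinuousOn (fun z : ℝ × ℝ => Z z.1 z.2) (genDomain ωm ωp)
  lower_lt : ∀ x x', (x, x') ∈ genDomain ωm ωp → a < Y x x'
  lt_upper : ∀ x x', (x, x') ∈ genDomain ωm ωp → (Y x x' : EReal) < b
  exists_fst : ∀ x' y : ℝ, a < y → (y : EReal) < b → ∃ x, (x, x') ∈ genDomain ωm ωp ∧ Z x x' = y

/-! ### From the twist map to the partial derivatives of its generating function. -/

namespace IsTwistMap

variable {a b ωm ωp : EReal} {F : ℝ × ℝ → ℝ × ℝ}

lemma strictMonoOn (hF : IsTwistMap a b ωm ωp F) (x : ℝ) :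
    StrictMonoOn (fun y => (F (x, y)).1) {y : ℝ | (x, y) ∈ strip a b} := by
  have hopen : IsOpen {y : ℝ | (x, y) ∈ strip a b} :=
    (isOpen_strip a b).preimage (by fun_prop : Continuous fun y : ℝ => (x, y))
  refine strictMonoOn_of_deriv_pos ?_ ?_ ?_
  · refine Set.OrdConnected.convex ⟨fun y₁ h₁ y₂ h₂ y hy => ?_⟩
    exact ⟨h₁.1.trans_le (EReal.coe_le_coe_iff.2 hy.1),
      (EReal.coe_le_coe_iff.2 hy.2).trans_lt h₂.2⟩
  · exact continuous_fst.comp_continuousOn (hF.contDiffOn.continuousOn.comp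
      (by fun_prop : Continuous fun y : ℝ => (x, y)).continuousOn fun y hy => hy)
  · intro y hy
    rw [hopen.interior_eq] at hy
    exact hF.twist x y hy

lemma exists_lower (hF : IsTwistMap a b ωm ωp F) {x c : ℝ} (hc : ωm < ((c - x : ℝ) : EReal)) :
    ∃ y, (x, y) ∈ strip a b ∧ (F (x, y)).1 < c := by
  induction a with
  | top => exact absurd hF.lt (by simp)
  | bot =>
    have h1 := (hF.lower_infinite rfl x).eventually (gt_mem_nhds hc)
    have h2 : ∀ᶠ y : ℝ in atBot, (y : EReal) < b := by
      obtain ⟨y₀, -, hy₀⟩ := EReal.lt_iff_exists_real_btwn.1 hF.lt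
      filter_upwards [eventually_le_atBot y₀] with y hy
      exact (EReal.coe_le_coe_iff.2 hy).trans_lt hy₀
    obtain ⟨y, hy1, hy2⟩ := (h1.and h2).exists
    refine ⟨y, ⟨EReal.bot_lt_coe y, hy2⟩, ?_⟩
    have := EReal.coe_lt_coe_iff.1 hy1
    linarith
  | coe a₀ =>
    obtain ⟨w, rfl, hw⟩ := hF.lower_finite a₀ rfl
    have h0 := EReal.coe_lt_coe_iff.1 hc
    obtain ⟨y₀, hy₀, hy₀'⟩ := EReal.lt_iff_exists_real_btwn.1 hF.lt
    have h1 : ∀ᶠ y : ℝ in 𝓝[>] a₀, (x, y) ∈ strip a₀ b := by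
      filter_upwards [self_mem_nhdsWithin,
        nhdsWithin_le_nhds (gt_mem_nhds (EReal.coe_lt_coe_iff.1 hy₀))] with y hy hy'
      exact ⟨EReal.coe_lt_coe_iff.2 hy, (EReal.coe_lt_coe_iff.2 hy').trans hy₀'⟩
    have h2 : Tendsto (fun y : ℝ => (x, y)) (𝓝[>] a₀) (𝓝[strip a₀ b] (x, a₀)) :=
      tendsto_nhdsWithin_iff.2 ⟨((by fun_prop : Continuous fun y : ℝ => (x, y)).tendsto a₀).mono_left
        nhdsWithin_le_nhds, h1⟩
    have h3 := (continuous_fst.tendsto _).comp ((hw x).comp h2)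
    have h4 := h3.eventually (gt_mem_nhds (show x + w < c by linarith))
    obtain ⟨y, hy1, hy2⟩ := (h1.and h4).exists
    exact ⟨y, hy1, hy2⟩

lemma exists_upper (hF : IsTwistMap a b ωm ωp F) {x c : ℝ} (hc : ((c - x : ℝ) : EReal) < ωp) :
    ∃ y, (x, y) ∈ strip a b ∧ c < (F (x, y)).1 := by
  induction b with
  | bot => exact absurd hF.lt (by simp)
  | top =>
    have h1 := (hF.upper_infinite rfl x).eventually (lt_mem_nhds hc)
    have h2 : ∀ᶠ y : ℝ in atTop, a < (y : EReal) := by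
      obtain ⟨y₀, hy₀, -⟩ := EReal.lt_iff_exists_real_btwn.1 hF.lt
      filter_upwards [eventually_ge_atTop y₀] with y hy
      exact hy₀.trans_le (EReal.coe_le_coe_iff.2 hy)
    obtain ⟨y, hy1, hy2⟩ := (h1.and h2).exists
    refine ⟨y, ⟨hy2, EReal.coe_lt_top y⟩, ?_⟩
    have := EReal.coe_lt_coe_iff.1 hy1
    linarith
  | coe b₀ =>
    obtain ⟨w, rfl, hw⟩ := hF.upper_finite b₀ rfl
    have h0 := EReal.coe_lt_coe_iff.1 hc
    obtain ⟨y₀, hy₀, hy₀'⟩ := EReal.lt_iff_exists_real_btwn.1 hF.lt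
    have h1 : ∀ᶠ y : ℝ in 𝓝[<] b₀, (x, y) ∈ strip a b₀ := by
      filter_upwards [self_mem_nhdsWithin,
        nhdsWithin_le_nhds (lt_mem_nhds (EReal.coe_lt_coe_iff.1 hy₀'))] with y hy hy'
      exact ⟨hy₀.trans (EReal.coe_lt_coe_iff.2 hy'), EReal.coe_lt_coe_iff.2 hy⟩
    have h2 : Tendsto (fun y : ℝ => (x, y)) (𝓝[<] b₀) (𝓝[strip a b₀] (x, b₀)) :=
      tendsto_nhdsWithin_iff.2 ⟨((by fun_prop : Continuous fun y : ℝ => (x, y)).tendsto b₀).mono_left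
        nhdsWithin_le_nhds, h1⟩
    have h3 := (continuous_fst.tendsto _).comp ((hw x).comp h2)
    have h4 := h3.eventually (lt_mem_nhds (show c < x + w by linarith))
    obtain ⟨y, hy1, hy2⟩ := (h1.and h4).exists
    exact ⟨y, hy1, hy2⟩

lemma exists_fst_eq (hF : IsTwistMap a b ωm ωp F) {x x' : ℝ} (h : (x, x') ∈ genDomain ωm ωp) :
    ∃ y, (x, y) ∈ strip a b ∧ (F (x, y)).1 = x' := by
  obtain ⟨y₁, h₁, h₁'⟩ := hF.exists_lower h.1
  obtain ⟨y₂, h₂, h₂'⟩ := hF.exists_upper h.2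
  have hlt : y₁ < y₂ := ((hF.strictMonoOn x).lt_iff_lt h₁ h₂).1 (h₁'.trans h₂')
  have hsub : ∀ y ∈ Set.Icc y₁ y₂, (x, y) ∈ strip a b := fun y hy =>
    ⟨h₁.1.trans_le (EReal.coe_le_coe_iff.2 hy.1), (EReal.coe_le_coe_iff.2 hy.2).trans_lt h₂.2⟩
  have hcont : ContinuousOn (fun y => (F (x, y)).1) (Set.Icc y₁ y₂) :=
    continuous_fst.comp_continuousOn (hF.contDiffOn.continuousOn.comp
      (by fun_prop : Continuous fun y : ℝ => (x, y)).continuousOn hsub)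
  obtain ⟨y, hy, hy'⟩ := intermediate_value_Icc hlt.le hcont ⟨h₁'.le, h₂'.le⟩
  exact ⟨y, hsub y hy, hy'⟩

theorem exists_isTwistPotential (hF : IsTwistMap a b ωm ωp F) {H : ℝ → ℝ → ℝ}
    (hH : IsGeneratingFunction a b ωm ωp F H) :
    ∃ Y Z : ℝ → ℝ → ℝ, IsTwistPotential a b ωm ωp H Y Z := by
  have hex : ∀ x x' : ℝ, (x, x') ∈ genDomain ωm ωp →
      ∃ y, (x, y) ∈ strip a b ∧ (F (x, y)).1 = x' := fun x x' h => hF.exists_fst_eq h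
  choose! Y hYs hYF using hex
  have hgen : ∀ x x', (x, x') ∈ genDomain ωm ωp →
      HasDerivAt (fun s => H s x') (-Y x x') x ∧
        HasDerivAt (fun s => H x s) (F (x, Y x x')).2 x' := fun x x' h =>
    ((hH.generates x (Y x x') x' _ (hYs x x' h)).1 (Prod.ext (hYF x x' h) rfl)).2
  have hmono : ∀ x x' x'', (x, x') ∈ genDomain ωm ωp → (x, x'') ∈ genDomain ωm ωp → x' < x'' →
      Y x x' < Y x x'' := by
    intro x x' x'' h h' hlt
    refine ((hF.strictMonoOn x).lt_iff_lt (hYs _ _ h) (hYs _ _ h')).1 ?_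
    simpa only [hYF _ _ h, hYF _ _ h'] using hlt
  -- Inversion of a monotone family: a fixed height `y₀` lies below (above) `Y` exactly when `F₁` at
  -- `y₀` is below (above) `x'`, and that is an open condition.
  have hcontY : ContinuousOn (fun z : ℝ × ℝ => Y z.1 z.2) (genDomain ωm ωp) := by
    rintro ⟨x, x'⟩ h
    refine ContinuousAt.continuousWithinAt ?_
    have hD : ∀ᶠ z : ℝ × ℝ in 𝓝 (x, x'), z ∈ genDomain ωm ωp := (isOpen_genDomain ωm ωp).mem_nhds h
    have hnear : ∀ y : ℝ, (x, y) ∈ strip a b →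
        (∀ᶠ z : ℝ × ℝ in 𝓝 (x, x'), (z.1, y) ∈ strip a b) ∧
        ContinuousAt (fun z : ℝ × ℝ => (F (z.1, y)).1) (x, x') := by
      intro y hy
      have hc : Continuous fun z : ℝ × ℝ => (z.1, y) := by fun_prop
      refine ⟨hc.continuousAt.eventually ((isOpen_strip a b).mem_nhds hy), ?_⟩
      exact continuous_fst.continuousAt.comp (ContinuousAt.comp (f := fun z : ℝ × ℝ => (z.1, y))
        (hF.contDiffOn.continuousOn.continuousAt ((isOpen_strip a b).mem_nhds hy)) hc.continuousAt)
    refine tendsto_order.2 ⟨fun c hc => ?_, fun c hc => ?_⟩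
    · obtain ⟨y₀, hy₀, hy₀'⟩ : ∃ y : ℝ, max a c < (y : EReal) ∧ (y : EReal) < Y x x' :=
        EReal.lt_iff_exists_real_btwn.1 (max_lt (hYs _ _ h).1 (EReal.coe_lt_coe_iff.2 hc))
      have hs : (x, y₀) ∈ strip a b := ⟨(le_max_left _ _).trans_lt hy₀, hy₀'.trans (hYs _ _ h).2⟩
      have hlt : (F (x, y₀)).1 < x' := by
        rw [← hYF x x' h]
        exact hF.strictMonoOn x hs (hYs _ _ h) (EReal.coe_lt_coe_iff.1 hy₀')
      have hcy := EReal.coe_lt_coe_iff.1 ((le_max_right _ _).trans_lt hy₀)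
      filter_upwards [hD, (hnear y₀ hs).1,
        (hnear y₀ hs).2.eventually_lt continuousAt_snd hlt] with z hz hz1 hz2
      refine hcy.trans (((hF.strictMonoOn z.1).lt_iff_lt hz1 (hYs _ _ hz)).1 ?_)
      simpa only [hYF _ _ hz] using hz2
    · obtain ⟨y₀, hy₀, hy₀'⟩ : ∃ y : ℝ, (Y x x' : EReal) < y ∧ (y : EReal) < min b c :=
        EReal.lt_iff_exists_real_btwn.1 (lt_min (hYs _ _ h).2 (EReal.coe_lt_coe_iff.2 hc))
      have hs : (x, y₀) ∈ strip a b := ⟨(hYs _ _ h).1.trans hy₀, hy₀'.trans_le (min_le_left _ _)⟩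
      have hlt : x' < (F (x, y₀)).1 := by
        rw [← hYF x x' h]
        exact hF.strictMonoOn x (hYs _ _ h) hs (EReal.coe_lt_coe_iff.1 hy₀)
      have hcy := EReal.coe_lt_coe_iff.1 (hy₀'.trans_le (min_le_right _ _))
      filter_upwards [hD, (hnear y₀ hs).1,
        continuousAt_snd.eventually_lt (hnear y₀ hs).2 hlt] with z hz hz1 hz2
      refine lt_trans (((hF.strictMonoOn z.1).lt_iff_lt (hYs _ _ hz) hz1).1 ?_) hcy
      simpa only [hYF _ _ hz] using hz2
  refine ⟨Y, fun x x' => (F (x, Y x x')).2, hH.periodic, fun x x' h => (hgen x x' h).1,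
    fun x x' h => (hgen x x' h).2, hmono, ?_, hcontY, ?_, fun x x' h => (hYs _ _ h).1,
    fun x x' h => (hYs _ _ h).2, ?_⟩
  -- By the crossing inequality `H x₁ s - H x₂ s` exceeds its value at `x'` for `s` to the right of
  -- `x'`, giving the weak inequality. Equality would give two points of the strip the same image.
  · intro x₁ x₂ x' h₁ h₂ hlt
    refine lt_of_le_of_ne ?_ fun heq => ?_
    · have hder := (hgen x₁ x' h₁).2.sub (hgen x₂ x' h₂).2
      have hev : ∀ᶠ s in 𝓝 x', (x₁, s) ∈ genDomain ωm ωp :=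
        (by fun_prop : Continuous fun s : ℝ => (x₁, s)).continuousAt.eventually
          ((isOpen_genDomain ωm ωp).mem_nhds h₁)
      obtain ⟨δ, hδ, hδ'⟩ := Metric.eventually_nhds_iff.1 hev
      have := nonneg_of_hasDerivAt_of_le_right hder hδ (fun s hs hs' => ?_)
      · linarith
      · have := cross_lt (fun x x' h => (hgen x x' h).1) hmono hlt hs
          (hδ' (by rw [Real.dist_eq, abs_lt]; constructor <;> linarith)) h₂
        simp only [Pi.sub_apply]
        linarith
    · have h3 : F (x₁, Y x₁ x') = F (x₂, Y x₂ x') :=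
        Prod.ext ((hYF _ _ h₁).trans (hYF _ _ h₂).symm) heq.symm
      have := hF.bijOn.injOn (hYs _ _ h₁) (hYs _ _ h₂) h3
      exact hlt.ne (congrArg Prod.fst this)
  · have : ContinuousOn (fun z : ℝ × ℝ => (z.1, Y z.1 z.2)) (genDomain ωm ωp) :=
      continuousOn_fst.prodMk hcontY
    exact continuous_snd.comp_continuousOn
      (hF.contDiffOn.continuousOn.comp this fun z hz => hYs _ _ hz)
  -- Surjectivity of `F`: every height below `b` is attained by `Z` over each `x'`. This is what
  -- later excludes extremal steps.
  · intro x' y hy hy'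
    obtain ⟨⟨x, v⟩, hs, hxv⟩ := hF.bijOn.surjOn (show (x', y) ∈ strip a b from ⟨hy, hy'⟩)
    have hmem := ((hH.generates x v x' y hs).1 hxv).1
    refine ⟨x, hmem, ?_⟩
    have : Y x x' = v := (hF.strictMonoOn x).injOn (hYs _ _ hmem) hs (by
      simp only [hYF _ _ hmem, hxv])
    simp only [this, hxv]

end IsTwistMap

lemma mul_sub_le_of_le_hasDerivAt {f f' : ℝ → ℝ} {c l r : ℝ} (hlr : l ≤ r)
    (hf : ∀ s ∈ Set.Icc l r, HasDerivAt f (f' s) s) (hc : ∀ s ∈ Set.Icc l r, c ≤ f' s) :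
    c * (r - l) ≤ f r - f l := by
  refine (convex_Icc l r).mul_sub_le_image_sub_of_le_deriv
    (fun s hs => (hf s hs).continuousAt.continuousWithinAt)
    (fun s hs => (hf s (interior_subset hs)).differentiableAt.differentiableWithinAt)
    (fun s hs => ?_) l (Set.left_mem_Icc.2 hlr) r (Set.right_mem_Icc.2 hlr) hlr
  rw [(hf s (interior_subset hs)).deriv]
  exact hc s (interior_subset hs)

/-! ### The extension of the generating function by lower limits. -/

section extend

variable {ωm ωp : EReal} {H : ℝ → ℝ → ℝ}

lemma le_extend {G : ℝ × ℝ → ℝ} {x x' : ℝ} (hG : ContinuousAt G (x, x'))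
    (h : ∀ᶠ z in 𝓝[genDomain ωm ωp] (x, x'), G z ≤ H z.1 z.2) :
    (G (x, x') : EReal) ≤ extend ωm ωp H x x' := by
  refine le_of_forall_lt_imp_le_of_dense fun c hc => ?_
  have hG' : ContinuousAt (fun z => (G z : EReal)) (x, x') :=
    continuous_coe_real_ereal.continuousAt.comp hG
  refine le_liminf_of_le (by isBoundedDefault) ?_
  filter_upwards [h, nhdsWithin_le_nhds (hG'.eventually (lt_mem_nhds hc))] with z hz hz'
  exact hz'.le.trans (EReal.coe_le_coe_iff.2 hz)

lemma lowerSemicontinuous_extend :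
    LowerSemicontinuous fun z : ℝ × ℝ => extend ωm ωp H z.1 z.2 := by
  intro z c hc
  obtain ⟨d, hcd, hd⟩ := exists_between hc
  have h1 : ∀ᶠ w in 𝓝[genDomain ωm ωp] z, d < (H w.1 w.2 : EReal) :=
    eventually_lt_of_lt_liminf hd
  have h2 := eventually_eventually_nhdsWithin.2 h1
  have h3 := eventually_nhdsWithin_iff.1 h1
  filter_upwards [eventually_eventually_nhds.2 h3] with y hy
  refine hcd.trans_le (le_liminf_of_le (by isBoundedDefault) ?_)
  exact (eventually_nhdsWithin_iff.2 hy).mono fun w hw => hw.le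

lemma le_and_le_of_extend_ne_top {x x' : ℝ} (h : extend ωm ωp H x x' ≠ ⊤) :
    ωm ≤ ((x' - x : ℝ) : EReal) ∧ ((x' - x : ℝ) : EReal) ≤ ωp := by
  by_contra hcon
  have hcl : IsClosed {z : ℝ × ℝ | ωm ≤ ((z.2 - z.1 : ℝ) : EReal) ∧
      ((z.2 - z.1 : ℝ) : EReal) ≤ ωp} :=
    (isClosed_le continuous_const
      (continuous_coe_real_ereal.comp (continuous_snd.sub continuous_fst))).inter
      (isClosed_le (continuous_coe_real_ereal.comp (continuous_snd.sub continuous_fst))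
        continuous_const)
  have hbot : 𝓝[genDomain ωm ωp] (x, x') = ⊥ := by
    rw [← notMem_closure_iff_nhdsWithin_eq_bot]
    intro hmem
    have hsub : genDomain ωm ωp ⊆ {z : ℝ × ℝ | ωm ≤ ((z.2 - z.1 : ℝ) : EReal) ∧
      ((z.2 - z.1 : ℝ) : EReal) ≤ ωp} := fun z hz => ⟨hz.1.le, hz.2.le⟩
    exact hcon (closure_minimal hsub hcl hmem)
  exact h (by rw [extend, hbot, liminf_bot])

lemma mem_genDomain_neg_iff {x x' : ℝ} :
    (x, x') ∈ genDomain (-ωp) (-ωm) ↔ (-x, -x') ∈ genDomain ωm ωp := by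
  have h : ((x' - x : ℝ) : EReal) = -((-x' - -x : ℝ) : EReal) := by
    rw [← EReal.coe_neg]; congr 1; ring
  simp only [genDomain, Set.mem_ofPred_eq, h, EReal.neg_lt_neg_iff]
  exact and_comm

lemma extend_neg (x x' : ℝ) :
    extend (-ωp) (-ωm) (fun s s' => H (-s) (-s')) x x' = extend ωm ωp H (-x) (-x') := by
  have hpre : genDomain (-ωp) (-ωm) = (fun z : ℝ × ℝ => -z) ⁻¹' genDomain ωm ωp := by
    ext ⟨s, s'⟩; exact mem_genDomain_neg_iff
  have hmap : map (fun z : ℝ × ℝ => -z) (𝓝[genDomain (-ωp) (-ωm)] (x, x')) =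
      𝓝[genDomain ωm ωp] (-x, -x') := by
    rw [hpre]
    exact (Homeomorph.neg (ℝ × ℝ)).isOpenEmbedding.map_nhdsWithin_preimage_eq _ _
  rw [extend, extend, ← hmap]
  rfl

lemma mem_genDomain_add_iff {x x' : ℝ} (k : ℝ) :
    (x + k, x' + k) ∈ genDomain ωm ωp ↔ (x, x') ∈ genDomain ωm ωp := by
  simp only [genDomain, Set.mem_ofPred_eq, add_sub_add_right_eq_sub]

/-- Even if both given pairs are boundary points, displacements strictly between theirs are
interior; an exchange of ends therefore produces interior steps. -/
lemma mem_genDomain_of_cross {x u x' u' : ℝ} (h₁ : extend ωm ωp H x u' ≠ ⊤)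
    (h₂ : extend ωm ωp H u x' ≠ ⊤)
    {s s' : ℝ} (hl : x' - u < s' - s) (hu : s' - s < u' - x) :
    (s, s') ∈ genDomain ωm ωp :=
  ⟨(le_and_le_of_extend_ne_top h₂).1.trans_lt (EReal.coe_lt_coe_iff.2 hl),
    (EReal.coe_lt_coe_iff.2 hu).trans_le (le_and_le_of_extend_ne_top h₁).2⟩

end extend

/-! ### Boundary behaviour, and the crossing inequality for the extension. -/

namespace IsTwistPotential

variable {a b ωm ωp : EReal} {H Y Z : ℝ → ℝ → ℝ}

lemma continuousAt (hP : IsTwistPotential a b ωm ωp H Y Z) {x x' : ℝ}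
    (h : (x, x') ∈ genDomain ωm ωp) : ContinuousAt (fun z : ℝ × ℝ => H z.1 z.2) (x, x') := by
  have hD := (isOpen_genDomain ωm ωp).mem_nhds h
  have hL : Continuous fun c : ℝ => ContinuousLinearMap.toSpanSingleton ℝ c :=
    (ContinuousLinearMap.toSpanSingletonCLE (𝕜 := ℝ) (E := ℝ)).continuous
  have := hasStrictFDerivAt_uncurry_coprod (𝕜 := ℝ) (u := (x, x')) (f := H)
    (f₁ := fun s s' => ContinuousLinearMap.toSpanSingleton ℝ (-Y s s'))
    (f₂ := fun s s' => ContinuousLinearMap.toSpanSingleton ℝ (Z s s'))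
    (by filter_upwards [hD] with z hz using (hP.deriv_fst z.1 z.2 hz).hasFDerivAt)
    (by filter_upwards [hD] with z hz using (hP.deriv_snd z.1 z.2 hz).hasFDerivAt)
    (hL.continuousAt.comp (hP.continuousOn_fst.continuousAt hD).neg)
    (hL.continuousAt.comp (hP.continuousOn_snd.continuousAt hD))
  exact this.continuousAt

/-- Conjugation by `(x, y) ↦ (-x, -y)` preserves the twist and swaps the two ends. It transfers
upper to lower boundary statements, and positive to negative `p`. -/
lemma neg (hP : IsTwistPotential a b ωm ωp H Y Z) :
    IsTwistPotential (-b) (-a) (-ωp) (-ωm) (fun x x' => H (-x) (-x'))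
      (fun x x' => -Y (-x) (-x')) (fun x x' => -Z (-x) (-x')) where
  periodic x x' k h := by
    have := hP.periodic (-x) (-x') (-k) (mem_genDomain_neg_iff.1 h)
    rw [← this]
    push_cast
    congr 1 <;> ring
  deriv_fst x x' h := by
    have := (hP.deriv_fst _ _ (mem_genDomain_neg_iff.1 h)).comp x (hasDerivAt_neg x)
    simpa [Function.comp_def] using this
  deriv_snd x x' h := by
    have := (hP.deriv_snd _ _ (mem_genDomain_neg_iff.1 h)).comp x' (hasDerivAt_neg x')
    simpa [Function.comp_def] using this
  strictMono x x' x'' h h' hlt := neg_lt_neg (hP.strictMono _ _ _ (mem_genDomain_neg_iff.1 h')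
    (mem_genDomain_neg_iff.1 h) (neg_lt_neg hlt))
  strictAnti x₁ x₂ x' h h' hlt := neg_lt_neg (hP.strictAnti _ _ _ (mem_genDomain_neg_iff.1 h')
    (mem_genDomain_neg_iff.1 h) (neg_lt_neg hlt))
  continuousOn_fst := (hP.continuousOn_fst.comp (continuous_neg (G := ℝ × ℝ)).continuousOn
    fun z hz => mem_genDomain_neg_iff.1 hz).neg
  continuousOn_snd := (hP.continuousOn_snd.comp (continuous_neg (G := ℝ × ℝ)).continuousOn
    fun z hz => mem_genDomain_neg_iff.1 hz).neg
  lower_lt x x' h := by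
    rw [EReal.coe_neg]
    exact EReal.neg_lt_neg_iff.2 (hP.lt_upper _ _ (mem_genDomain_neg_iff.1 h))
  lt_upper x x' h := by
    rw [EReal.coe_neg]
    exact EReal.neg_lt_neg_iff.2 (hP.lower_lt _ _ (mem_genDomain_neg_iff.1 h))
  exists_fst x' y hy hy' := by
    obtain ⟨x, hx, hxy⟩ := hP.exists_fst (-x') (-y)
      (by rw [EReal.coe_neg]; exact EReal.lt_neg_comm.1 hy')
      (by rw [EReal.coe_neg]; exact EReal.neg_lt_comm.1 hy)
    refine ⟨-x, mem_genDomain_neg_iff.2 (by simpa using hx), ?_⟩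
    simp [hxy]

lemma extend_eq (hP : IsTwistPotential a b ωm ωp H Y Z) {x x' : ℝ}
    (h : (x, x') ∈ genDomain ωm ωp) : extend ωm ωp H x x' = H x x' := by
  have : Tendsto (fun z : ℝ × ℝ => (H z.1 z.2 : EReal)) (𝓝[genDomain ωm ωp] (x, x'))
      (𝓝 (H x x' : EReal)) := by
    rw [(isOpen_genDomain ωm ωp).nhdsWithin_eq h]
    exact continuous_coe_real_ereal.continuousAt.comp (hP.continuousAt h)
  have hne : (𝓝[genDomain ωm ωp] (x, x')).NeBot := by
    rw [(isOpen_genDomain ωm ωp).nhdsWithin_eq h]; infer_instance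
  exact this.liminf_eq

/-- At the upper end of the twist interval the vertical coordinate reaches `b`, so that shortening
a step of maximal length at the cost of the next one lowers the action. -/
lemma exists_lt_of_upper (hP : IsTwistPotential a b ωm ωp H Y Z) {x v w : ℝ} (hω : ωm < ωp)
    (hv : ωp = ((v - x : ℝ) : EReal)) (hw : ωm ≤ ((w - v : ℝ) : EReal))
    (hw' : ((w - v : ℝ) : EReal) < ωp) :
    ∃ δ > 0, ∀ t, 0 < t → t < δ → (x, v - t) ∈ genDomain ωm ωp ∧ (v - t, w) ∈ genDomain ωm ωp ∧
      ((H x (v - t) + H (v - t) w : ℝ) : EReal) < extend ωm ωp H x v + extend ωm ωp H v w := by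
  -- The pair `(v, v + c)` is interior even when `w - v = ωm`, and `Y` there dominates `Y` at nearby
  -- pairs with second entry near `w`. The number `e` keeps the shortened first step above `ωm`.
  obtain ⟨c, hc, hc'⟩ := EReal.lt_iff_exists_real_btwn.1 hw'
  obtain ⟨e, he, he'⟩ := EReal.lt_iff_exists_real_btwn.1 hω
  have hcv : c < v - x := by rw [hv] at hc'; exact EReal.coe_lt_coe_iff.1 hc'
  have hev : e < v - x := by rw [hv] at he'; exact EReal.coe_lt_coe_iff.1 he'
  have hwc := EReal.coe_lt_coe_iff.1 hc
  have hmem : (v, v + c) ∈ genDomain ωm ωp := by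
    constructor <;> simp only [add_sub_cancel_left]
    exacts [hw.trans_lt hc, hc']
  -- Heights `Y v (v + c) < β' < β < β₂ < b`. The point `xs` with `Z xs v = β₂` lies to the right of
  -- `x`, so `Z > β` near `(x, v)`, while `Y < β'` near `(v, w)`. Moving `v` back by `t` gains at
  -- least `β * t` on the first step and costs at most `β' * t` on the second.
  obtain ⟨β', hβ', hβ'b⟩ := EReal.lt_iff_exists_real_btwn.1 (hP.lt_upper _ _ hmem)
  obtain ⟨β, hβ, hβb⟩ := EReal.lt_iff_exists_real_btwn.1 hβ'b
  obtain ⟨β₂, hβ₂, hβ₂b⟩ := EReal.lt_iff_exists_real_btwn.1 hβb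
  obtain ⟨xs, hxs, hZ⟩ := hP.exists_fst v β₂
    (((hP.lower_lt _ _ hmem).trans hβ').trans (hβ.trans hβ₂)) hβ₂b
  rw [EReal.coe_lt_coe_iff] at hβ' hβ hβ₂
  have hxxs : x < xs := by
    have := hxs.2
    rw [hv] at this
    have := EReal.coe_lt_coe_iff.1 this
    linarith
  have hA : ∀ᶠ s in 𝓝 v, (xs, s) ∈ genDomain ωm ωp ∧ β < Z xs s := by
    have hc1 : ContinuousAt (fun s : ℝ => (xs, s)) v := by fun_prop
    have hm := (isOpen_genDomain ωm ωp).mem_nhds hxs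
    refine (hc1.eventually hm).and ?_
    exact (ContinuousAt.comp (f := fun s : ℝ => (xs, s)) (hP.continuousOn_snd.continuousAt hm)
      hc1).eventually (lt_mem_nhds (by simpa [hZ] using hβ₂))
  have hB : ∀ᶠ s in 𝓝 v, (s, v + c) ∈ genDomain ωm ωp ∧ Y s (v + c) < β' := by
    have hc1 : ContinuousAt (fun s : ℝ => (s, v + c)) v := by fun_prop
    have hm := (isOpen_genDomain ωm ωp).mem_nhds hmem
    refine (hc1.eventually hm).and ?_
    exact (ContinuousAt.comp (f := fun s : ℝ => (s, v + c)) (hP.continuousOn_fst.continuousAt hm)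
      hc1).eventually (gt_mem_nhds hβ')
  obtain ⟨δ, hδ, hAB⟩ := Metric.eventually_nhds_iff.1 (hA.and hB)
  refine ⟨min δ (min (v - x - e) (c - (w - v))), lt_min hδ (lt_min (by linarith) (by linarith)),
    fun t ht htd => ?_⟩
  obtain ⟨htδ, hte, htc⟩ : t < δ ∧ t < v - x - e ∧ t < c - (w - v) :=
    ⟨htd.trans_le (min_le_left _ _), (htd.trans_le (min_le_right _ _)).trans_le (min_le_left _ _),
      (htd.trans_le (min_le_right _ _)).trans_le (min_le_right _ _)⟩
  have hm1 : (x, v - t) ∈ genDomain ωm ωp := by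
    refine ⟨he.trans (EReal.coe_lt_coe_iff.2 (by simp only; linarith)), ?_⟩
    rw [hv]; exact EReal.coe_lt_coe_iff.2 (by simp only; linarith)
  have hm2 : (v - t, w) ∈ genDomain ωm ωp :=
    ⟨hw.trans_lt (EReal.coe_lt_coe_iff.2 (by simp only; linarith)),
      (EReal.coe_lt_coe_iff.2 (by simp only; linarith)).trans hc'⟩
  -- The derivative bound is integrated at domain points near `(x, v)`, then passed to the lower
  -- limit.
  have hE1 : ((H x (v - t) + β * t : ℝ) : EReal) ≤ extend ωm ωp H x v := by
    have hc1 : ContinuousAt (fun z : ℝ × ℝ => (z.1, v - t)) (x, v) := by fun_prop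
    have := le_extend (ωm := ωm) (ωp := ωp) (H := H) (x := x) (x' := v)
      (G := fun z => H z.1 (v - t) + β * (z.2 - (v - t))) ?_ ?_
    · simpa using this
    · exact (ContinuousAt.comp (f := fun z : ℝ × ℝ => (z.1, v - t)) (hP.continuousAt hm1) hc1).add
        (by fun_prop)
    · filter_upwards [self_mem_nhdsWithin,
        nhdsWithin_le_nhds (hc1.eventually ((isOpen_genDomain ωm ωp).mem_nhds hm1)),
        nhdsWithin_le_nhds (continuousAt_fst.eventually (gt_mem_nhds hxxs)),
        nhdsWithin_le_nhds (continuousAt_snd.eventually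
          (lt_mem_nhds (show v - t < v by linarith))),
        nhdsWithin_le_nhds (continuousAt_snd.eventually
          (gt_mem_nhds (show v < v + δ by linarith)))] with z hz hz1 hzx hzl hzu
      replace hz1 : (z.1, v - t) ∈ genDomain ωm ωp := hz1
      have hsub : ∀ s ∈ Set.Icc (v - t) z.2, (z.1, s) ∈ genDomain ωm ωp := fun s hs =>
        genDomain_of_le hz1 hz (by simp only; linarith [hs.1]) (by linarith [hs.2])
      have := mul_sub_le_of_le_hasDerivAt hzl.le (fun s hs => hP.deriv_snd z.1 s (hsub s hs))
        (c := β) (fun s hs => by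
          have := (hAB (y := s)
            (by rw [Real.dist_eq, abs_lt]; constructor <;> linarith [hs.1, hs.2])).1
          exact this.2.le.trans (hP.strictAnti _ _ _ (hsub s hs) this.1 hzx).le)
      linarith
  have hE2 : ((H (v - t) w - β' * t : ℝ) : EReal) ≤ extend ωm ωp H v w := by
    have hc1 : ContinuousAt (fun z : ℝ × ℝ => (v - t, z.2)) (v, w) := by fun_prop
    have := le_extend (ωm := ωm) (ωp := ωp) (H := H) (x := v) (x' := w)
      (G := fun z => H (v - t) z.2 - β' * (z.1 - (v - t))) ?_ ?_
    · simpa using this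
    · exact (ContinuousAt.comp (f := fun z : ℝ × ℝ => (v - t, z.2)) (hP.continuousAt hm2) hc1).sub
        (by fun_prop)
    · filter_upwards [self_mem_nhdsWithin,
        nhdsWithin_le_nhds (hc1.eventually ((isOpen_genDomain ωm ωp).mem_nhds hm2)),
        nhdsWithin_le_nhds (continuousAt_snd.eventually
          (gt_mem_nhds (show w < v + c by linarith))),
        nhdsWithin_le_nhds (continuousAt_fst.eventually
          (lt_mem_nhds (show v - t < v by linarith))),
        nhdsWithin_le_nhds (continuousAt_fst.eventually
          (gt_mem_nhds (show v < v + δ by linarith)))] with z hz hz1 hzx hzl hzu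
      replace hz1 : (v - t, z.2) ∈ genDomain ωm ωp := hz1
      have hsub : ∀ s ∈ Set.Icc (v - t) z.1, (s, z.2) ∈ genDomain ωm ωp := fun s hs =>
        genDomain_of_le hz hz1 (by linarith [hs.2]) (by simp only; linarith [hs.1])
      have := mul_sub_le_of_le_hasDerivAt hzl.le (fun s hs => hP.deriv_fst s z.2 (hsub s hs))
        (c := -β') (fun s hs => by
          have := (hAB (y := s)
            (by rw [Real.dist_eq, abs_lt]; constructor <;> linarith [hs.1, hs.2])).2
          exact neg_le_neg ((hP.strictMono _ _ _ (hsub s hs) this.1 hzx).trans this.2).le)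
      linarith
  refine ⟨hm1, hm2, lt_of_lt_of_le ?_ (add_le_add hE1 hE2)⟩
  rw [← EReal.coe_add, EReal.coe_lt_coe_iff]
  nlinarith [mul_pos ht (sub_pos.2 hβ)]

lemma exists_lt_of_lower (hP : IsTwistPotential a b ωm ωp H Y Z) {x v w : ℝ} (hω : ωm < ωp)
    (hv : ωm = ((v - x : ℝ) : EReal)) (hw : ωm < ((w - v : ℝ) : EReal))
    (hw' : ((w - v : ℝ) : EReal) ≤ ωp) :
    ∃ δ > 0, ∀ t, 0 < t → t < δ → (x, v + t) ∈ genDomain ωm ωp ∧ (v + t, w) ∈ genDomain ωm ωp ∧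
      ((H x (v + t) + H (v + t) w : ℝ) : EReal) < extend ωm ωp H x v + extend ωm ωp H v w := by
  have hcoe : ((-w - -v : ℝ) : EReal) = -((w - v : ℝ) : EReal) := by
    rw [← EReal.coe_neg]; congr 1; ring
  obtain ⟨δ, hδ, h⟩ := hP.neg.exists_lt_of_upper (x := -x) (v := -v) (w := -w)
    (EReal.neg_lt_neg_iff.2 hω) (by rw [hv, ← EReal.coe_neg]; congr 1; ring)
    (by rw [hcoe]; exact EReal.neg_le_neg_iff.2 hw')
    (by rw [hcoe]; exact EReal.neg_lt_neg_iff.2 hw)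
  refine ⟨δ, hδ, fun t ht htd => ?_⟩
  obtain ⟨h1, h2, h3⟩ := h t ht htd
  rw [mem_genDomain_neg_iff] at h1 h2
  rw [extend_neg, extend_neg] at h3
  have hvt : -(-v - t) = v + t := by ring
  simp only [neg_neg, hvt] at h1 h2 h3
  exact ⟨h1, h2, h3⟩

/-- At a boundary pair, follow it by an interior step `e`: the strict inequality for a moved middle
point would put a real number below `⊥`. -/
lemma extend_ne_bot (hP : IsTwistPotential a b ωm ωp H Y Z) (hω : ωm < ωp) (x x' : ℝ) :
    extend ωm ωp H x x' ≠ ⊥ := by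
  intro hbot
  obtain ⟨h1, h2⟩ := le_and_le_of_extend_ne_top (ωm := ωm) (ωp := ωp) (H := H) (x := x) (x' := x')
    (by simp [hbot])
  obtain ⟨e, he, he'⟩ := EReal.lt_iff_exists_real_btwn.1 hω
  have hcoe : ((x' + e - x' : ℝ) : EReal) = e := by congr 1; ring
  rcases h1.eq_or_lt with h1 | h1
  · obtain ⟨δ, hδ, h⟩ := hP.exists_lt_of_lower (w := x' + e) hω h1 (by rwa [hcoe])
      (by rw [hcoe]; exact he'.le)
    have := (h (δ / 2) (by linarith) (by linarith)).2.2
    rw [hbot, EReal.bot_add] at this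
    exact not_lt_bot this
  · rcases h2.eq_or_lt with h2 | h2
    · obtain ⟨δ, hδ, h⟩ := hP.exists_lt_of_upper (w := x' + e) hω h2.symm
        (by rw [hcoe]; exact he.le) (by rwa [hcoe])
      have := (h (δ / 2) (by linarith) (by linarith)).2.2
      rw [hbot, EReal.bot_add] at this
      exact not_lt_bot this
    · rw [hP.extend_eq ⟨h1, h2⟩] at hbot
      exact EReal.coe_ne_bot _ hbot

lemma extend_add_intCast (hP : IsTwistPotential a b ωm ωp H Y Z) (x x' : ℝ) (k : ℤ) :
    extend ωm ωp H (x + k) (x' + k) = extend ωm ωp H x x' := by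
  have hpre : genDomain ωm ωp =
      (fun z : ℝ × ℝ => z + ((k : ℝ), (k : ℝ))) ⁻¹' genDomain ωm ωp := by
    ext ⟨s, s'⟩; exact (mem_genDomain_add_iff (k : ℝ)).symm
  have hmap : map (fun z : ℝ × ℝ => z + ((k : ℝ), (k : ℝ))) (𝓝[genDomain ωm ωp] (x, x')) =
      𝓝[genDomain ωm ωp] (x + k, x' + k) := by
    conv_lhs => rw [hpre]
    exact (Homeomorph.addRight ((k : ℝ), (k : ℝ))).isOpenEmbedding.map_nhdsWithin_preimage_eq _ _
  rw [extend, extend, ← hmap, ← liminf_comp]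
  refine liminf_congr ?_
  filter_upwards [self_mem_nhdsWithin] with z hz
  simp only [Function.comp, Prod.fst_add, Prod.snd_add, hP.periodic _ _ k hz]

lemma cross_lt (hP : IsTwistPotential a b ωm ωp H Y Z) {x u x' u' : ℝ} (hx : x < u)
    (hx' : x' < u') (h₁ : (x, u') ∈ genDomain ωm ωp) (h₂ : (u, x') ∈ genDomain ωm ωp) :
    H x x' + H u u' < H x u' + H u x' :=
  MonotoneTwist.cross_lt hP.deriv_fst hP.strictMono hx hx' h₁ h₂

/-- Two successive lower limits of the interior inequality: first `w → (x, u')` with `z` fixed near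
`(u, x')`, then `z → (u, x')`. The other two corners are interior, so `H` is continuous there. -/
lemma cross_le_extend (hP : IsTwistPotential a b ωm ωp H Y Z) {x u x' u' h k : ℝ} (hx : x < u)
    (hx' : x' < u') (h₁ : extend ωm ωp H x u' = h) (h₂ : extend ωm ωp H u x' = k) :
    H x x' + H u u' ≤ h + k := by
  have hm1 : (x, x') ∈ genDomain ωm ωp :=
    mem_genDomain_of_cross (H := H) (x := x) (u := u) (x' := x') (u' := u')
      (by simp [h₁]) (by simp [h₂]) (by linarith) (by linarith)
  have hm2 : (u, u') ∈ genDomain ωm ωp :=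
    mem_genDomain_of_cross (H := H) (x := x) (u := u) (x' := x') (u' := u')
      (by simp [h₁]) (by simp [h₂]) (by linarith) (by linarith)
  have hc1 : ContinuousAt (fun z : ℝ × ℝ => (x, z.2)) (u, x') := by fun_prop
  have hc2 : ContinuousAt (fun z : ℝ × ℝ => (z.1, u')) (u, x') := by fun_prop
  have key := le_extend (ωm := ωm) (ωp := ωp) (H := H) (x := u) (x' := x')
    (G := fun z => H x z.2 + H z.1 u' - h) ?_ ?_
  · rw [h₂, EReal.coe_le_coe_iff] at key
    simp only at key
    linarith
  · exact ((ContinuousAt.comp (f := fun z : ℝ × ℝ => (x, z.2)) (hP.continuousAt hm1) hc1).add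
      (ContinuousAt.comp (f := fun z : ℝ × ℝ => (z.1, u')) (hP.continuousAt hm2) hc2)).sub
      continuousAt_const
  · filter_upwards [self_mem_nhdsWithin,
      nhdsWithin_le_nhds (hc1.eventually ((isOpen_genDomain ωm ωp).mem_nhds hm1)),
      nhdsWithin_le_nhds (hc2.eventually ((isOpen_genDomain ωm ωp).mem_nhds hm2)),
      nhdsWithin_le_nhds (continuousAt_fst.eventually (lt_mem_nhds hx)),
      nhdsWithin_le_nhds (continuousAt_snd.eventually (gt_mem_nhds hx'))] with z hz hz1 hz2 hzx hzx'
    replace hz1 : (x, z.2) ∈ genDomain ωm ωp := hz1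
    replace hz2 : (z.1, u') ∈ genDomain ωm ωp := hz2
    have hc3 : ContinuousAt (fun w : ℝ × ℝ => (w.1, z.2)) (x, u') := by fun_prop
    have hc4 : ContinuousAt (fun w : ℝ × ℝ => (z.1, w.2)) (x, u') := by fun_prop
    have key := le_extend (ωm := ωm) (ωp := ωp) (H := H) (x := x) (x' := u')
      (G := fun w => H w.1 z.2 + H z.1 w.2 - H z.1 z.2) ?_ ?_
    · rw [h₁, EReal.coe_le_coe_iff] at key
      simp only at key
      linarith
    · exact ((ContinuousAt.comp (f := fun w : ℝ × ℝ => (w.1, z.2)) (hP.continuousAt hz1) hc3).add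
        (ContinuousAt.comp (f := fun w : ℝ × ℝ => (z.1, w.2)) (hP.continuousAt hz2) hc4)).sub
        continuousAt_const
    · filter_upwards [self_mem_nhdsWithin,
        nhdsWithin_le_nhds (continuousAt_fst.eventually (gt_mem_nhds hzx)),
        nhdsWithin_le_nhds (continuousAt_snd.eventually (lt_mem_nhds hzx'))] with w hw hwx hwx'
      linarith [hP.cross_lt hwx hwx' hw hz]

/-- Limits lose strictness; cutting `[x, u]` at `m₁ < m₂` restores it. The outer rectangles may
touch the boundary and give `≤`, the middle one is interior and gives `<`. -/
lemma cross_lt_extend (hP : IsTwistPotential a b ωm ωp H Y Z) {x u x' u' h k : ℝ} (hx : x < u)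
    (hx' : x' < u') (h₁ : extend ωm ωp H x u' = h) (h₂ : extend ωm ωp H u x' = k) :
    H x x' + H u u' < h + k := by
  obtain ⟨m₁, hm₁, hm₁'⟩ := exists_between hx
  obtain ⟨m₂, hm₂, hm₂'⟩ := exists_between hm₁'
  have hmem : ∀ s s', x' - u < s' - s → s' - s < u' - x → (s, s') ∈ genDomain ωm ωp :=
    fun s s' => mem_genDomain_of_cross (H := H) (x := x) (u := u) (x' := x') (u' := u')
      (by simp [h₁]) (by simp [h₂])
  have e1 := hP.cross_le_extend hm₁ hx' h₁
    (hP.extend_eq (hmem m₁ x' (by linarith) (by linarith)))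
  have e2 := hP.cross_le_extend hm₂' hx'
    (hP.extend_eq (hmem m₂ u' (by linarith) (by linarith))) h₂
  have e3 := hP.cross_lt hm₂ hx' (hmem m₁ u' (by linarith) (by linarith))
    (hmem m₂ x' (by linarith) (by linarith))
  linarith

end IsTwistPotential

/-! ### Extended real sums and periodic sequences. -/

lemma ereal_sum_ne_bot {ι : Type*} {s : Finset ι} {f : ι → EReal} (h : ∀ i ∈ s, f i ≠ ⊥) :
    ∑ i ∈ s, f i ≠ ⊥ := by
  classical
  induction s using Finset.induction_on with
  | empty => simp
  | insert i s hi ih =>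
    rw [Finset.sum_insert hi, Ne, EReal.add_eq_bot_iff, not_or]
    exact ⟨h i (Finset.mem_insert_self i s), ih fun j hj => h j (Finset.mem_insert_of_mem hj)⟩

lemma ereal_ne_top_of_sum_ne_top {ι : Type*} {s : Finset ι} {f : ι → EReal}
    (h : ∀ i ∈ s, f i ≠ ⊥) (hs : ∑ i ∈ s, f i ≠ ⊤) {i : ι} (hi : i ∈ s) : f i ≠ ⊤ := by
  classical
  intro htop
  rw [← Finset.add_sum_erase s f hi, htop, EReal.top_add_of_ne_bot] at hs
  · exact hs rfl
  · exact ereal_sum_ne_bot fun j hj => h j (Finset.mem_of_mem_erase hj)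

lemma ereal_coe_sum {ι : Type*} (s : Finset ι) (f : ι → ℝ) :
    ((∑ i ∈ s, f i : ℝ) : EReal) = ∑ i ∈ s, (f i : EReal) := by
  classical
  induction s using Finset.induction_on with
  | empty => simp
  | insert i s hi ih => rw [Finset.sum_insert hi, Finset.sum_insert hi, EReal.coe_add, ih]

lemma lowerSemicontinuous_ereal_sum {α ι : Type*} [TopologicalSpace α] (s : Finset ι)
    {f : ι → α → EReal} (hf : ∀ i ∈ s, LowerSemicontinuous (f i)) (h : ∀ i ∈ s, ∀ x, f i x ≠ ⊥) :
    LowerSemicontinuous fun x => ∑ i ∈ s, f i x := by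
  classical
  induction s using Finset.induction_on with
  | empty => simpa using lowerSemicontinuous_const
  | insert i s hi ih =>
    simp only [Finset.sum_insert hi]
    refine (hf i (Finset.mem_insert_self i s)).add'
      (ih (fun j hj => hf j (Finset.mem_insert_of_mem hj))
        fun j hj => h j (Finset.mem_insert_of_mem hj)) fun x => ?_
    exact EReal.continuousAt_add
      (Or.inr (ereal_sum_ne_bot fun j hj => h j (Finset.mem_insert_of_mem hj) x))
      (Or.inl (h i (Finset.mem_insert_self i s) x))

lemma sum_range_periodic {M : Type*} [AddCommMonoid M] {f : ℤ → M} {r : ℕ}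
    (hf : ∀ n, f (n + r) = f n) (m : ℤ) :
    ∑ n ∈ Finset.range r, f (m + n) = ∑ n ∈ Finset.range r, f n := by
  have step : ∀ m : ℤ, ∑ n ∈ Finset.range r, f (m + 1 + n) = ∑ n ∈ Finset.range r, f (m + n) := by
    intro m
    cases r with
    | zero => simp
    | succ r =>
      rw [Finset.sum_range_succ, Finset.sum_range_succ']
      congr 1
      · refine Finset.sum_congr rfl fun n _ => congrArg f ?_
        push_cast; ring
      · rw [← hf (m + ((0 : ℕ) : ℤ))]
        congr 1
        push_cast; ring
  induction m using Int.induction_on with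
  | zero => simp
  | succ i ih => rw [step, ih]
  | pred i ih => rw [← ih, ← step]; simp

/-- The real value of the extended generating function where it is finite. -/
noncomputable def realExtend (ωm ωp : EReal) (H : ℝ → ℝ → ℝ) (x x' : ℝ) : ℝ :=
  (extend ωm ωp H x x').toReal

/-- The periodic sequences of finite action. -/
def admissible (ωm ωp : EReal) (H : ℝ → ℝ → ℝ) (p : ℤ) (r : ℕ) : Set (ℤ → ℝ) :=
  {x | x ∈ periodicSeqs p r ∧ ∀ n, extend ωm ωp H (x n) (x (n + 1)) ≠ ⊤}

noncomputable def realAction (ωm ωp : EReal) (H : ℝ → ℝ → ℝ) (r : ℕ) (x : ℤ → ℝ) : ℝ :=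
  ∑ n ∈ Finset.range r, realExtend ωm ωp H (x (n : ℤ)) (x ((n : ℤ) + 1))

/-- The minimizers of the action among the `(p, r)`-periodic sequences of finite action. -/
def IsActionMin (ωm ωp : EReal) (H : ℝ → ℝ → ℝ) (p : ℤ) (r : ℕ) (x : ℤ → ℝ) : Prop :=
  x ∈ admissible ωm ωp H p r ∧
    ∀ y ∈ admissible ωm ωp H p r, realAction ωm ωp H r x ≤ realAction ωm ωp H r y

lemma periodicSeqs_add_mul {p : ℤ} {r : ℕ} {x : ℤ → ℝ} (hx : x ∈ periodicSeqs p r) (n k : ℤ) :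
    x (n + k * r) = x n + k * p := by
  induction k using Int.induction_on with
  | zero => simp
  | succ i ih =>
    have := hx.1 (n + i * r)
    rw [ih] at this
    rw [show n + (i + 1) * (r : ℤ) = n + i * r + r by ring, this]
    push_cast; ring
  | pred i ih =>
    have := hx.1 (n + (-i - 1) * r)
    rw [show n + (-i - 1) * (r : ℤ) + r = n + -i * r by ring, ih] at this
    push_cast at this ⊢
    linarith

lemma shift_mem_periodicSeqs {p : ℤ} {r : ℕ} {x : ℤ → ℝ} (hx : x ∈ periodicSeqs p r) (m : ℤ)
    (c : ℝ) : (fun n => x (m + n) + c) ∈ periodicSeqs p r := by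
  refine ⟨fun n => ?_, fun hp i j hij => ?_, fun hp i j hij => ?_⟩
  · simp only [← add_assoc, hx.1]; ring
  · simpa using hx.2.1 hp (show m + i ≤ m + j by lia)
  · simpa using hx.2.2 hp (show m + i ≤ m + j by lia)

/-! ### Existence of minimizers and their local minimality. -/

namespace IsTwistPotential

variable {a b ωm ωp : EReal} {H Y Z : ℝ → ℝ → ℝ} {p : ℤ} {r : ℕ} {x y : ℤ → ℝ}

lemma coe_realExtend (hP : IsTwistPotential a b ωm ωp H Y Z) (hω : ωm < ωp) {s s' : ℝ}
    (h : extend ωm ωp H s s' ≠ ⊤) : (realExtend ωm ωp H s s' : EReal) = extend ωm ωp H s s' :=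
  EReal.coe_toReal h (hP.extend_ne_bot hω s s')

lemma realExtend_eq (hP : IsTwistPotential a b ωm ωp H Y Z) {s s' : ℝ}
    (h : (s, s') ∈ genDomain ωm ωp) : realExtend ωm ωp H s s' = H s s' := by
  rw [realExtend, hP.extend_eq h, EReal.toReal_coe]

lemma extend_ne_top (hP : IsTwistPotential a b ωm ωp H Y Z) {s s' : ℝ}
    (h : (s, s') ∈ genDomain ωm ωp) : extend ωm ωp H s s' ≠ ⊤ := by
  rw [hP.extend_eq h]; exact EReal.coe_ne_top _

lemma realExtend_add_intCast (hP : IsTwistPotential a b ωm ωp H Y Z) (s s' : ℝ) (k : ℤ) :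
    realExtend ωm ωp H (s + k) (s' + k) = realExtend ωm ωp H s s' := by
  rw [realExtend, hP.extend_add_intCast, realExtend]

lemma action_eq (hP : IsTwistPotential a b ωm ωp H Y Z) (hω : ωm < ωp)
    (hx : x ∈ admissible ωm ωp H p r) :
    action ωm ωp H r x = realAction ωm ωp H r x := by
  rw [action, realAction, ereal_coe_sum]
  exact Finset.sum_congr rfl fun n _ => (hP.coe_realExtend hω (hx.2 n)).symm

lemma extend_periodic (hP : IsTwistPotential a b ωm ωp H Y Z) (hx : x ∈ periodicSeqs p r)
    (n : ℤ) : extend ωm ωp H (x (n + r)) (x (n + r + 1)) = extend ωm ωp H (x n) (x (n + 1)) := by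
  rw [show n + r + 1 = n + 1 + (r : ℤ) by ring, hx.1, hx.1, hP.extend_add_intCast]

lemma admissible_of_action_ne_top (hP : IsTwistPotential a b ωm ωp H Y Z) (hω : ωm < ωp)
    (hr : 0 < r) (hx : x ∈ periodicSeqs p r) (h : action ωm ωp H r x ≠ ⊤) :
    x ∈ admissible ωm ωp H p r := by
  refine ⟨hx, fun n => ?_⟩
  have hr' : (0 : ℤ) < r := by exact_mod_cast hr
  obtain ⟨j, hj⟩ := Int.eq_ofNat_of_zero_le (Int.emod_nonneg n hr'.ne')
  have hjr : j < r := by have := Int.emod_lt_of_pos n hr'; lia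
  have hn : n = j + (n / r) * r := by rw [← hj]; exact (Int.emod_add_ediv_mul n r).symm
  have := ereal_ne_top_of_sum_ne_top (fun i _ => hP.extend_ne_bot hω _ _) h
    (Finset.mem_range.2 hjr)
  rw [hn, show (j : ℤ) + n / r * r + 1 = j + 1 + n / r * r by ring, periodicSeqs_add_mul hx,
    periodicSeqs_add_mul hx]
  have hc := hP.extend_add_intCast (x j) (x (j + 1)) (n / r * p)
  push_cast at hc
  rwa [hc]

lemma realAction_shift (hP : IsTwistPotential a b ωm ωp H Y Z) (hx : x ∈ periodicSeqs p r)
    (m : ℤ) : ∑ n ∈ Finset.range r, realExtend ωm ωp H (x (m + n)) (x (m + n + 1)) =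
      realAction ωm ωp H r x :=
  sum_range_periodic (f := fun n => realExtend ωm ωp H (x n) (x (n + 1)))
    (fun n => by simp only [realExtend, hP.extend_periodic hx]) m

lemma isActionMin_shift (hP : IsTwistPotential a b ωm ωp H Y Z)
    (hx : IsActionMin ωm ωp H p r x) (m : ℤ) :
    IsActionMin ωm ωp H p r fun n => x (m + n) := by
  have hmem : (fun n => x (m + n)) ∈ periodicSeqs p r := by
    simpa using shift_mem_periodicSeqs hx.1.1 m 0
  refine ⟨⟨hmem, fun n => ?_⟩, fun y hy => ?_⟩
  · simpa only [add_assoc] using hx.1.2 (m + n)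
  · have := hP.realAction_shift hx.1.1 m
    simp only [add_assoc] at this
    rw [realAction, this]
    exact hx.2 y hy

/-- A finite monotone chain of `r` steps from `g 0` to `g 0 + p` extends periodically. -/
lemma exists_admissible (hP : IsTwistPotential a b ωm ωp H Y Z) (hp : 0 < p) (hr : 0 < r)
    {g : ℕ → ℝ} (hg : g r = g 0 + p) (hmono : ∀ j < r, g j ≤ g (j + 1))
    (hfin : ∀ j < r, extend ωm ωp H (g j) (g (j + 1)) ≠ ⊤) :
    ∃ y ∈ admissible ωm ωp H p r, (∀ j ≤ r, y (j : ℤ) = g j) ∧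
      realAction ωm ωp H r y = ∑ j ∈ Finset.range r, realExtend ωm ωp H (g j) (g (j + 1)) := by
  have hr' : (0 : ℤ) < r := by exact_mod_cast hr
  let y : ℤ → ℝ := fun n => g (n % r).toNat + (n / r : ℤ) * p
  have hy0 : ∀ j < r, ∀ k : ℤ, y (j + k * r) = g j + k * p := by
    intro j hj k
    have hj' : (j : ℤ) < r := by exact_mod_cast hj
    simp only [y, Int.add_mul_emod_self_right, Int.add_mul_ediv_right _ _ hr'.ne',
      Int.emod_eq_of_lt (Int.natCast_nonneg j) hj', Int.ediv_eq_zero_of_lt (Int.natCast_nonneg j) hj',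
      Int.toNat_natCast, zero_add]
  -- The index `j = r` wraps round to the next period; this is where `g r = g 0 + p` enters.
  have hyr : ∀ j ≤ r, ∀ k : ℤ, y (j + k * r) = g j + k * p := by
    intro j hj k
    rcases hj.lt_or_eq with hj | rfl
    · exact hy0 j hj k
    · have := hy0 0 hr (k + 1)
      rw [show (j : ℤ) + k * j = ((0 : ℕ) : ℤ) + (k + 1) * j by push_cast; ring, this, hg]
      push_cast; ring
  have hdecomp : ∀ n : ℤ, ∃ j < r, ∃ k : ℤ, n = j + k * r := by
    intro n
    obtain ⟨j, hj⟩ := Int.eq_ofNat_of_zero_le (Int.emod_nonneg n hr'.ne')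
    refine ⟨j, by have := Int.emod_lt_of_pos n hr'; lia, n / r, ?_⟩
    rw [← hj]; exact (Int.emod_add_ediv_mul n r).symm
  have hstep : ∀ j < r, ∀ k : ℤ, y (j + k * r) = g j + ((k * p : ℤ) : ℝ) ∧
      y (j + k * r + 1) = g (j + 1) + ((k * p : ℤ) : ℝ) := by
    intro j hj k
    have := hyr (j + 1) hj k
    push_cast at this ⊢
    exact ⟨hyr j hj.le k, by rw [← this]; congr 1; ring⟩
  have hyj : ∀ j ≤ r, y (j : ℤ) = g j := fun j hj => by simpa using hyr j hj 0
  refine ⟨y, ⟨⟨fun n => ?_, fun _ => ?_, fun h => absurd h (not_le.2 hp)⟩, fun n => ?_⟩, hyj, ?_⟩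
  · obtain ⟨j, hj, k, rfl⟩ := hdecomp n
    rw [show (j : ℤ) + k * r + r = j + (k + 1) * r by ring, hy0 j hj, hy0 j hj]
    push_cast; ring
  · refine monotone_int_of_le_succ fun n => ?_
    obtain ⟨j, hj, k, rfl⟩ := hdecomp n
    rw [(hstep j hj k).1, (hstep j hj k).2]
    linarith [hmono j hj]
  · obtain ⟨j, hj, k, rfl⟩ := hdecomp n
    rw [(hstep j hj k).1, (hstep j hj k).2, hP.extend_add_intCast]
    exact hfin j hj
  · refine Finset.sum_congr rfl fun j hj => ?_
    have hj' := Finset.mem_range.1 hj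
    rw [hyj j hj'.le, ← hyj (j + 1) hj']
    push_cast; rfl

/-- Direct method. An integer translation puts `x 0` in `[0, 1]`; monotonicity and periodicity then
bound every term, so the class is compact in the product topology, and the action is lower
semicontinuous. -/
lemma exists_isActionMin (hP : IsTwistPotential a b ωm ωp H Y Z) (hω : ωm < ωp) (hp : 0 < p)
    (hr : 0 < r) (htop : minAction ωm ωp H p r ≠ ⊤) :
    ∃ x, IsActionMin ωm ωp H p r x ∧ minAction ωm ωp H p r = realAction ωm ωp H r x := by
  have hr' : (0 : ℤ) < r := by exact_mod_cast hr
  let K : Set (ℤ → ℝ) := {x | x ∈ periodicSeqs p r ∧ x 0 ∈ Set.Icc (0 : ℝ) 1}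
  have hKsub : K ⊆ Set.univ.pi fun n : ℤ => Set.Icc (-(|n| * p) : ℝ) (1 + |n| * p) := by
    rintro x ⟨hx, hx0⟩ n -
    have h1 := periodicSeqs_add_mul hx 0 (|n|)
    have h2 := periodicSeqs_add_mul hx 0 (-|n|)
    have hn : |n| ≤ |n| * r := le_mul_of_one_le_right (abs_nonneg n) hr'
    have h3 := hx.2.1 hp.le (show n ≤ 0 + |n| * r by linarith [le_abs_self n])
    have h4 := hx.2.1 hp.le (show 0 + -|n| * r ≤ n by linarith [neg_abs_le n])
    push_cast at h1 h2
    constructor <;> push_cast <;> linarith [hx0.1, hx0.2]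
  have hKclosed : IsClosed K := by
    have hK : K = (⋂ n : ℤ, {x : ℤ → ℝ | x (n + r) = x n + p}) ∩
        (⋂ n : ℤ, {x : ℤ → ℝ | x n ≤ x (n + 1)}) ∩ {x | x 0 ∈ Set.Icc (0 : ℝ) 1} := by
      ext x
      constructor
      · rintro ⟨hx, hx0⟩
        exact ⟨⟨Set.mem_iInter.2 hx.1, Set.mem_iInter.2 fun n => hx.2.1 hp.le (by lia)⟩, hx0⟩
      · rintro ⟨⟨h1, h2⟩, hx0⟩
        exact ⟨⟨Set.mem_iInter.1 h1, fun _ => monotone_int_of_le_succ (Set.mem_iInter.1 h2),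
          fun h => absurd h (not_le.2 hp)⟩, hx0⟩
    rw [hK]
    refine ((isClosed_iInter fun n => isClosed_eq ?_ ?_).inter
      (isClosed_iInter fun n => isClosed_le ?_ ?_)).inter (isClosed_Icc.preimage ?_) <;> fun_prop
  have hKcompact : IsCompact K :=
    (isCompact_univ_pi fun n => isCompact_Icc).of_isClosed_subset hKclosed hKsub
  have hKmem : ∀ x ∈ periodicSeqs p r, ∃ y ∈ K, action ωm ωp H r y = action ωm ωp H r x := by
    intro x hx
    refine ⟨fun n => x n + ((-⌊x 0⌋ : ℤ) : ℝ), ⟨?_, ?_⟩, ?_⟩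
    · simpa using shift_mem_periodicSeqs hx 0 ((-⌊x 0⌋ : ℤ) : ℝ)
    · push_cast
      constructor
      · linarith [Int.floor_le (x 0)]
      · linarith [Int.lt_floor_add_one (x 0)]
    · exact Finset.sum_congr rfl fun n _ => hP.extend_add_intCast _ _ _
  have hlsc : LowerSemicontinuous (action ωm ωp H r) := by
    refine lowerSemicontinuous_ereal_sum _ (fun n _ => ?_) fun n _ x => hP.extend_ne_bot hω _ _
    exact lowerSemicontinuous_extend.comp
      (g := fun x : ℤ → ℝ => (x (n : ℤ), x ((n : ℤ) + 1))) (by fun_prop)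
  have hKne : K.Nonempty := by
    by_contra hne
    refine htop ?_
    have : periodicSeqs p r = ∅ := by
      by_contra h
      obtain ⟨x, hx⟩ := Set.nonempty_iff_ne_empty.2 h
      obtain ⟨y, hy, -⟩ := hKmem x hx
      exact hne ⟨y, hy⟩
    rw [minAction, this, Set.image_empty, sInf_empty]
  obtain ⟨x, hxK, hx⟩ := (hlsc.lowerSemicontinuousOn K).exists_isMinOn hKne hKcompact
  have hmin : ∀ y ∈ periodicSeqs p r, action ωm ωp H r x ≤ action ωm ωp H r y := by
    intro y hy
    obtain ⟨z, hz, hzy⟩ := hKmem y hy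
    rw [← hzy]; exact hx hz
  have hval : minAction ωm ωp H p r = action ωm ωp H r x :=
    le_antisymm (sInf_le ⟨x, hxK.1, rfl⟩) (le_sInf (by rintro _ ⟨y, hy, rfl⟩; exact hmin y hy))
  have hadm := hP.admissible_of_action_ne_top hω hr hxK.1 (hval ▸ htop)
  refine ⟨x, ⟨hadm, fun y hy => ?_⟩, by rw [hval, hP.action_eq hω hadm]⟩
  have := hmin y hy.1
  rwa [hP.action_eq hω hadm, hP.action_eq hω hy, EReal.coe_le_coe_iff] at this

lemma minAction_ne_bot (hP : IsTwistPotential a b ωm ωp H Y Z) (hω : ωm < ωp) (hp : 0 < p)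
    (hr : 0 < r) : minAction ωm ωp H p r ≠ ⊥ := by
  by_cases htop : minAction ωm ωp H p r = ⊤
  · simp [htop]
  · obtain ⟨x, -, hx⟩ := hP.exists_isActionMin hω hp hr htop
    rw [hx]; exact EReal.coe_ne_bot _

lemma minAction_ne_top (hP : IsTwistPotential a b ωm ωp H Y Z) (hω : ωm < ωp) (hp : 0 < p)
    (hr : 0 < r) (hlo : ωm < (((p : ℝ) / (r : ℝ) : ℝ) : EReal))
    (hhi : (((p : ℝ) / (r : ℝ) : ℝ) : EReal) < ωp) : minAction ωm ωp H p r ≠ ⊤ := by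
  have hr0 : (0 : ℝ) < r := by exact_mod_cast hr
  have hp0 : (0 : ℝ) < p := by exact_mod_cast hp
  -- Equally spaced points have finite action.
  have hadm : (fun n : ℤ => (n : ℝ) * (p / r)) ∈ admissible ωm ωp H p r := by
    refine ⟨⟨fun n => ?_, fun _ i j hij => ?_, fun h => absurd h (not_le.2 hp)⟩, fun n => ?_⟩
    · push_cast; field_simp
    · have : (i : ℝ) ≤ j := by exact_mod_cast hij
      exact mul_le_mul_of_nonneg_right this (by positivity)
    · refine hP.extend_ne_top ?_
      have : ((n + 1 : ℤ) : ℝ) * (p / r) - n * (p / r) = (p : ℝ) / r := by push_cast; ring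
      constructor <;> simp only [this]
      exacts [hlo, hhi]
  have := sInf_le (Set.mem_image_of_mem (action ωm ωp H r) hadm.1)
  rw [hP.action_eq hω hadm] at this
  exact (this.trans_lt (EReal.coe_lt_top _)).ne

/-- A minimizer is locally minimal: moving one term does not lower the action. -/
lemma local_min (hP : IsTwistPotential a b ωm ωp H Y Z) (hp : 0 < p) (hr : 2 ≤ r)
    (hx : IsActionMin ωm ωp H p r x) {m : ℤ} {v : ℝ} (hv : x m ≤ v) (hv' : v ≤ x (m + 1 + 1))
    (h₁ : extend ωm ωp H (x m) v ≠ ⊤) (h₂ : extend ωm ωp H v (x (m + 1 + 1)) ≠ ⊤) :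
    realExtend ωm ωp H (x m) (x (m + 1)) + realExtend ωm ωp H (x (m + 1)) (x (m + 1 + 1)) ≤
      realExtend ωm ωp H (x m) v + realExtend ωm ωp H v (x (m + 1 + 1)) := by
  obtain ⟨k, rfl⟩ := Nat.exists_eq_add_of_le' hr
  have hper : x (m + (k + 1) + 1) = x m + p := by
    rw [← hx.1.1.1 m]; congr 1; push_cast; ring
  have hper' : x (m + (k + 1) + 1 + 1) = x (m + 1) + p := by
    rw [← hx.1.1.1 (m + 1)]; congr 1; push_cast; ring
  -- One period starting at the moved term: `v, x (m + 2), …, x m + p, v + p`. Only the first and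
  -- last steps differ from those of `x`.
  let g : ℕ → ℝ := fun j => if j = 0 then v else if j = k + 2 then v + p else x (m + 1 + j)
  have hg0 : g 0 = v := rfl
  have hgk : g (k + 2) = v + p := by simp [g]
  have hgj : ∀ j < k + 1, g (j + 1) = x (m + 1 + j + 1) := by
    intro j hj
    have : j ≠ k + 1 := hj.ne
    simp only [g, Nat.add_eq_zero_iff, one_ne_zero, and_false, if_false,
      show ¬ (j + 1 = k + 2) by lia]
    push_cast; congr 1; ring
  have hg1 : g 1 = x (m + 1 + 1) := by simpa using hgj 0 (by lia)
  have hgl : g (k + 1) = x m + p := by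
    rw [hgj k (by lia), ← hper]; congr 1; ring
  have hcases : ∀ j < k + 2, j = 0 ∨ j = k + 1 ∨ ∃ i < k, j = i + 1 := by
    intro j hj
    rcases j with _ | i
    · exact Or.inl rfl
    · rcases Nat.lt_succ_iff_lt_or_eq.1 (show i < k + 1 by lia) with h | h
      · exact Or.inr (Or.inr ⟨i, h, rfl⟩)
      · exact Or.inr (Or.inl (by lia))
  have hgmono : ∀ j < k + 2, g j ≤ g (j + 1) := by
    intro j hj
    have hmono := hx.1.1.2.1 hp.le
    rcases hcases j hj with rfl | rfl | ⟨i, hi, rfl⟩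
    · rw [hg0, zero_add, hg1]; exact hv'
    · rw [hgl, hgk]; linarith
    · rw [hgj i (by lia), hgj (i + 1) (by lia)]
      exact hmono (by push_cast; lia)
  have hgfin : ∀ j < k + 2, extend ωm ωp H (g j) (g (j + 1)) ≠ ⊤ := by
    intro j hj
    rcases hcases j hj with rfl | rfl | ⟨i, hi, rfl⟩
    · rwa [hg0, zero_add, hg1]
    · rwa [hgl, hgk, hP.extend_add_intCast]
    · rw [hgj i (by lia), hgj (i + 1) (by lia)]
      have := hx.1.2 (m + 1 + i + 1)
      push_cast
      rwa [show m + 1 + ((i : ℤ) + 1) + 1 = m + 1 + i + 1 + 1 by ring]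
  obtain ⟨y, hy, -, hyact⟩ := hP.exists_admissible (r := k + 2) hp (by lia)
    (g := g) (by rw [hgk, hg0]) hgmono hgfin
  have h1 := hx.2 y hy
  rw [hyact, ← hP.realAction_shift hx.1.1 (m + 1), Finset.sum_range_succ, Finset.sum_range_succ',
    Finset.sum_range_succ, Finset.sum_range_succ', hg0, hg1, hgl, hgk,
    hP.realExtend_add_intCast] at h1
  have h2 : ∑ j ∈ Finset.range k, realExtend ωm ωp H (g (j + 1)) (g (j + 1 + 1)) =
      ∑ j ∈ Finset.range k, realExtend ωm ωp H (x (m + 1 + (j + 1 : ℕ)))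
        (x (m + 1 + (j + 1 : ℕ) + 1)) := by
    refine Finset.sum_congr rfl fun j hj => ?_
    have hj' := Finset.mem_range.1 hj
    rw [hgj j (by lia), hgj (j + 1) (by lia)]
    push_cast
    simp only [add_assoc]
  have h3 : realExtend ωm ωp H (x (m + 1 + (k + 1 : ℕ))) (x (m + 1 + (k + 1 : ℕ) + 1)) =
      realExtend ωm ωp H (x m) (x (m + 1)) := by
    rw [← hP.realExtend_add_intCast (x m) (x (m + 1)) p, ← hper, ← hper']
    push_cast
    congr 2 <;> ring
  rw [h2, h3] at h1
  simp only [Nat.cast_zero, add_zero] at h1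
  linarith


end IsTwistPotential

/-! ### Comparison of periodic sequences. -/

lemma periodicSeqs_le {p : ℤ} {r : ℕ} {x y : ℤ → ℝ} (hr : 0 < r) (hx : x ∈ periodicSeqs p r)
    (hy : y ∈ periodicSeqs p r) (h : ∀ j < r, x (j : ℤ) ≤ y (j : ℤ)) (n : ℤ) : x n ≤ y n := by
  have hr' : (0 : ℤ) < r := by exact_mod_cast hr
  obtain ⟨j, hj⟩ := Int.eq_ofNat_of_zero_le (Int.emod_nonneg n hr'.ne')
  have hn : n = j + (n / r) * r := by rw [← hj]; exact (Int.emod_add_ediv_mul n r).symm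
  have := h j (by have := Int.emod_lt_of_pos n hr'; lia)
  rw [hn, periodicSeqs_add_mul hx, periodicSeqs_add_mul hy]
  linarith

/-- The sequence with the larger rotation number overtakes the other one. -/
lemma exists_nested {p : ℤ} {k l : ℕ} {x z : ℤ → ℝ} (hp : 0 < p) (hkl : k < l)
    (hx : x ∈ periodicSeqs p k) (hz : z ∈ periodicSeqs p l) :
    ∃ n, x n ≤ z n ∧ z (n + 1) ≤ x (n + 1) := by
  -- Otherwise `x n ≤ z n` propagates forward for ever. But over `N * k * l` indices `x` gains `N *
  -- l * p` and `z` only `N * k * p`, so for large `N` it holds at `-N * k * l` and fails at `N * k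
  -- * l`.
  by_contra! hcon
  have hp' : (0 : ℝ) < p := by exact_mod_cast hp
  have hkl' : (1 : ℝ) ≤ l - k := by
    have : ((k + 1 : ℕ) : ℝ) ≤ l := by exact_mod_cast hkl
    push_cast at this; linarith
  obtain ⟨N, hN⟩ := exists_nat_gt (|x 0 - z 0| / p)
  have hN' : |x 0 - z 0| < N * p := (div_lt_iff₀ hp').1 hN
  have hNp : (N : ℝ) * p ≤ N * p * (l - k) := le_mul_of_one_le_right (by positivity) hkl'
  have key : ∀ s : ℤ, x (s * (k * l)) = x 0 + s * l * p ∧ z (s * (k * l)) = z 0 + s * k * p := by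
    intro s
    have h1 := periodicSeqs_add_mul hx 0 (s * l)
    have h2 := periodicSeqs_add_mul hz 0 (s * k)
    rw [zero_add] at h1 h2
    push_cast at h1 h2
    rw [← h1, ← h2]
    constructor <;> congr 1 <;> ring
  have hind : ∀ n : ℤ, -(N : ℤ) * (k * l) ≤ n → x n ≤ z n := by
    intro n hn
    induction n, hn using Int.leInduction with
    | base =>
      rw [(key _).1, (key _).2]
      push_cast
      nlinarith [le_abs_self (x 0 - z 0)]
    | succ n _ ih => exact (hcon n ih).le
  have hpos : (0 : ℤ) ≤ N * (k * l) := by positivity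
  have := hind (N * (k * l)) (by linarith)
  have hk := key N
  push_cast at hk
  rw [hk.1, hk.2] at this
  nlinarith [neg_abs_le (x 0 - z 0)]

/-! ### Minimizers: interior steps, strict monotonicity, touching. -/

namespace IsTwistPotential

variable {a b ωm ωp : EReal} {H Y Z : ℝ → ℝ → ℝ} {p : ℤ} {r : ℕ} {x y : ℤ → ℝ}

lemma realExtend_cross (hP : IsTwistPotential a b ωm ωp H Y Z) (hω : ωm < ωp) {s t s' t' : ℝ}
    (hs : s ≤ t) (hs' : s' ≤ t') (h₁ : extend ωm ωp H s t' ≠ ⊤) (h₂ : extend ωm ωp H t s' ≠ ⊤) :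
    extend ωm ωp H s s' ≠ ⊤ ∧ extend ωm ωp H t t' ≠ ⊤ ∧
      realExtend ωm ωp H s s' + realExtend ωm ωp H t t' ≤
        realExtend ωm ωp H s t' + realExtend ωm ωp H t s' ∧
      (s < t → s' < t' → realExtend ωm ωp H s s' + realExtend ωm ωp H t t' <
        realExtend ωm ωp H s t' + realExtend ωm ωp H t s') := by
  rcases hs.eq_or_lt with rfl | hs
  · exact ⟨h₂, h₁, (add_comm _ _).le, fun h => absurd h (lt_irrefl _)⟩
  rcases hs'.eq_or_lt with rfl | hs'
  · exact ⟨h₁, h₂, le_rfl, fun _ h => absurd h (lt_irrefl _)⟩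
  have hm1 : (s, s') ∈ genDomain ωm ωp :=
    mem_genDomain_of_cross h₁ h₂ (by linarith) (by linarith)
  have hm2 : (t, t') ∈ genDomain ωm ωp :=
    mem_genDomain_of_cross h₁ h₂ (by linarith) (by linarith)
  have hlt := hP.cross_lt_extend hs hs' (hP.coe_realExtend hω h₁).symm
    (hP.coe_realExtend hω h₂).symm
  rw [← hP.realExtend_eq hm1, ← hP.realExtend_eq hm2] at hlt
  exact ⟨hP.extend_ne_top hm1, hP.extend_ne_top hm2, hlt.le, fun _ _ => hlt⟩

/-- The crossing inequality read as submodularity: only when the two steps cross does taking maximum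
and minimum change the pairs. -/
lemma realExtend_max_min (hP : IsTwistPotential a b ωm ωp H Y Z) (hω : ωm < ωp) {s t s' t' : ℝ}
    (h₁ : extend ωm ωp H s s' ≠ ⊤) (h₂ : extend ωm ωp H t t' ≠ ⊤) :
    extend ωm ωp H (max s t) (max s' t') ≠ ⊤ ∧ extend ωm ωp H (min s t) (min s' t') ≠ ⊤ ∧
      realExtend ωm ωp H (max s t) (max s' t') + realExtend ωm ωp H (min s t) (min s' t') ≤
        realExtend ωm ωp H s s' + realExtend ωm ωp H t t' ∧
      (t < s → s' < t' →
        realExtend ωm ωp H (max s t) (max s' t') + realExtend ωm ωp H (min s t) (min s' t') <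
        realExtend ωm ωp H s s' + realExtend ωm ωp H t t') := by
  rcases le_total s t with hs | hs <;> rcases le_total s' t' with hs' | hs'
  · simp only [max_eq_right hs, max_eq_right hs', min_eq_left hs, min_eq_left hs']
    exact ⟨h₂, h₁, (add_comm _ _).le, fun h => absurd h hs.not_gt⟩
  · simp only [max_eq_right hs, max_eq_left hs', min_eq_left hs, min_eq_right hs']
    obtain ⟨e1, e2, e3, -⟩ := hP.realExtend_cross hω hs hs' h₁ h₂
    exact ⟨e2, e1, by linarith, fun h => absurd h hs.not_gt⟩
  · simp only [max_eq_left hs, max_eq_right hs', min_eq_right hs, min_eq_left hs']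
    obtain ⟨e1, e2, e3, e4⟩ := hP.realExtend_cross hω hs hs' h₂ h₁
    exact ⟨e2, e1, by linarith, fun h h' => by linarith [e4 h h']⟩
  · simp only [max_eq_left hs, max_eq_left hs', min_eq_right hs, min_eq_right hs']
    exact ⟨h₁, h₂, le_rfl, fun _ h => absurd h hs'.not_gt⟩

/-- The steps of a minimizer are interior to the twist interval. -/
lemma isActionMin_mem_genDomain (hP : IsTwistPotential a b ωm ωp H Y Z) (hp : 0 < p) (hr : 0 < r)
    (hlo : ωm < (((p : ℝ) / (r : ℝ) : ℝ) : EReal)) (hhi : (((p : ℝ) / (r : ℝ) : ℝ) : EReal) < ωp)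
    (hx : IsActionMin ωm ωp H p r x) (n : ℤ) : (x n, x (n + 1)) ∈ genDomain ωm ωp := by
  have hω := hlo.trans hhi
  have hr0 : (0 : ℝ) < r := by exact_mod_cast hr
  have hp0 : (0 : ℝ) < p := by exact_mod_cast hp
  have hmono := hx.1.1.2.1 hp.le
  rcases (show r = 1 ∨ 2 ≤ r by lia) with rfl | hr2
  · have h := hx.1.1.1 n
    rw [Nat.cast_one] at h
    rw [Nat.cast_one, div_one] at hlo hhi
    constructor <;> simpa only [h, add_sub_cancel_left]
  -- The mean step is `p / r`, which is interior; so an extremal step is eventually followed by a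
  -- different one, and the term between the two can be moved to lower the action.
  have hconst : ∀ c : ℝ, (∀ m : ℤ, n ≤ m → x (m + 1) - x m = c) → (p : ℝ) / r = c := by
    intro c hc
    have : ∀ i : ℕ, x (n + i) = x n + i * c := by
      intro i
      induction i with
      | zero => simp
      | succ i ih =>
        have := hc (n + i) (by lia)
        push_cast
        rw [← add_assoc]
        linarith
    have h := this r
    rw [hx.1.1.1 n] at h
    rw [div_eq_iff hr0.ne']
    linarith
  have hexists : ∀ c : ℝ, x (n + 1) - x n = c → (p : ℝ) / r ≠ c →
      ∃ m : ℤ, x (m + 1) - x m = c ∧ x (m + 1 + 1) - x (m + 1) ≠ c := by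
    intro c hn hne
    by_contra! hcon
    refine hne (hconst c fun m hm => ?_)
    induction m, hm using Int.leInduction with
    | base => exact hn
    | succ m _ ih => exact hcon m ih
  obtain ⟨h1, h2⟩ := le_and_le_of_extend_ne_top (hx.1.2 n)
  refine ⟨h1.lt_of_ne fun heq => ?_, h2.lt_of_ne fun heq => ?_⟩
  · obtain ⟨m, hm, hm'⟩ := hexists _ rfl (by
      rw [heq, EReal.coe_lt_coe_iff] at hlo; exact hlo.ne')
    rw [← hm] at heq hm'
    obtain ⟨h3, h4⟩ := le_and_le_of_extend_ne_top (hx.1.2 (m + 1))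
    have h5 : x (m + 1) - x m < x (m + 1 + 1) - x (m + 1) := by
      rw [heq, EReal.coe_le_coe_iff] at h3
      exact lt_of_le_of_ne h3 hm'.symm
    obtain ⟨δ, hδ, h⟩ := hP.exists_lt_of_lower hω heq
      (by rw [heq]; exact EReal.coe_lt_coe_iff.2 h5) h4
    have h6 := hmono (show m ≤ m + 1 by lia)
    have hd : 0 < x (m + 1 + 1) - x (m + 1) := by linarith
    obtain ⟨t, ht, ht'⟩ := exists_between (lt_min hδ hd)
    obtain ⟨e1, e2, e3⟩ := h t ht (ht'.trans_le (min_le_left _ _))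
    have := hP.local_min hp hr2 hx (m := m) (v := x (m + 1) + t) (by linarith)
      (by linarith [ht'.trans_le (min_le_right _ _)]) (hP.extend_ne_top e1) (hP.extend_ne_top e2)
    rw [← hP.realExtend_eq e1, ← hP.realExtend_eq e2, ← hP.coe_realExtend hω (hx.1.2 m),
      ← hP.coe_realExtend hω (hx.1.2 (m + 1)), ← EReal.coe_add, EReal.coe_lt_coe_iff] at e3
    linarith
  · obtain ⟨m, hm, hm'⟩ := hexists _ rfl (by
      rw [← heq, EReal.coe_lt_coe_iff] at hhi; exact hhi.ne)
    rw [← hm] at heq hm'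
    obtain ⟨h3, h4⟩ := le_and_le_of_extend_ne_top (hx.1.2 (m + 1))
    have h5 : x (m + 1 + 1) - x (m + 1) < x (m + 1) - x m := by
      rw [← heq, EReal.coe_le_coe_iff] at h4
      exact lt_of_le_of_ne h4 hm'
    obtain ⟨δ, hδ, h⟩ := hP.exists_lt_of_upper hω heq.symm h3
      (by rw [← heq]; exact EReal.coe_lt_coe_iff.2 h5)
    -- Moving the term back must keep the sequence monotone; there is room because `ωp > p / r > 0`.
    have hd : 0 < x (m + 1) - x m := by
      rw [← heq, EReal.coe_lt_coe_iff] at hhi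
      exact (div_pos hp0 hr0).trans hhi
    obtain ⟨t, ht, ht'⟩ := exists_between (lt_min hδ hd)
    obtain ⟨e1, e2, e3⟩ := h t ht (ht'.trans_le (min_le_left _ _))
    have := hP.local_min hp hr2 hx (m := m) (v := x (m + 1) - t)
      (by linarith [ht'.trans_le (min_le_right _ _)])
      (by linarith [hmono (show m + 1 ≤ m + 1 + 1 by lia)])
      (hP.extend_ne_top e1) (hP.extend_ne_top e2)
    rw [← hP.realExtend_eq e1, ← hP.realExtend_eq e2, ← hP.coe_realExtend hω (hx.1.2 m),
      ← hP.coe_realExtend hω (hx.1.2 (m + 1)), ← EReal.coe_add, EReal.coe_lt_coe_iff] at e3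
    linarith

lemma exists_local_min (hP : IsTwistPotential a b ωm ωp H Y Z) (hp : 0 < p) (hr : 2 ≤ r)
    (hx : IsActionMin ωm ωp H p r x) (hD : ∀ n, (x n, x (n + 1)) ∈ genDomain ωm ωp) (m : ℤ) :
    ∃ δ > 0, ∀ v, |v - x (m + 1)| < δ → x m ≤ v → v ≤ x (m + 1 + 1) →
      H (x m) (x (m + 1)) + H (x (m + 1)) (x (m + 1 + 1)) ≤ H (x m) v + H v (x (m + 1 + 1)) := by
  have h1 : ∀ᶠ v in 𝓝 (x (m + 1)), (x m, v) ∈ genDomain ωm ωp :=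
    (by fun_prop : Continuous fun v : ℝ => (x m, v)).continuousAt.eventually
      ((isOpen_genDomain ωm ωp).mem_nhds (hD m))
  have h2 : ∀ᶠ v in 𝓝 (x (m + 1)), (v, x (m + 1 + 1)) ∈ genDomain ωm ωp :=
    (by fun_prop : Continuous fun v : ℝ => (v, x (m + 1 + 1))).continuousAt.eventually
      ((isOpen_genDomain ωm ωp).mem_nhds (hD (m + 1)))
  obtain ⟨δ, hδ, h⟩ := Metric.eventually_nhds_iff.1 (h1.and h2)
  refine ⟨δ, hδ, fun v hv hl hu => ?_⟩
  obtain ⟨e1, e2⟩ := h (y := v) (by rwa [Real.dist_eq])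
  have := hP.local_min hp hr hx hl hu (hP.extend_ne_top e1) (hP.extend_ne_top e2)
  rwa [hP.realExtend_eq e1, hP.realExtend_eq e2, hP.realExtend_eq (hD m),
    hP.realExtend_eq (hD (m + 1))] at this

lemma hasDerivAt_middle (hP : IsTwistPotential a b ωm ωp H Y Z) {s t u : ℝ}
    (h₁ : (s, t) ∈ genDomain ωm ωp) (h₂ : (t, u) ∈ genDomain ωm ωp) :
    HasDerivAt (fun v => H s v + H v u) (Z s t + -Y t u) t :=
  (hP.deriv_snd s t h₁).add (hP.deriv_fst t u h₂)

/-- A strict increase before the term leaves room to move it left only, so the monotonicity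
constraint yields just one half of the stationarity equation `Z = Y`. -/
lemma snd_le_fst_of_lt (hP : IsTwistPotential a b ωm ωp H Y Z) (hp : 0 < p) (hr : 2 ≤ r)
    (hx : IsActionMin ωm ωp H p r x) (hD : ∀ n, (x n, x (n + 1)) ∈ genDomain ωm ωp) {m : ℤ}
    (hlt : x m < x (m + 1)) : Z (x m) (x (m + 1)) ≤ Y (x (m + 1)) (x (m + 1 + 1)) := by
  obtain ⟨δ, hδ, h⟩ := hP.exists_local_min hp hr hx hD m
  have hmono := hx.1.1.2.1 hp.le (show m + 1 ≤ m + 1 + 1 by lia)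
  have := nonpos_of_hasDerivAt_of_le_left (hP.hasDerivAt_middle (hD m) (hD (m + 1)))
    (lt_min hδ (sub_pos.2 hlt)) fun s hs hs' => h s
      (by rw [abs_lt]; constructor <;> linarith [min_le_left δ (x (m + 1) - x m)])
      (by linarith [min_le_right δ (x (m + 1) - x m)]) (hs'.le.trans hmono)
  linarith

lemma fst_le_snd_of_lt (hP : IsTwistPotential a b ωm ωp H Y Z) (hp : 0 < p) (hr : 2 ≤ r)
    (hx : IsActionMin ωm ωp H p r x) (hD : ∀ n, (x n, x (n + 1)) ∈ genDomain ωm ωp) {m : ℤ}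
    (hlt : x (m + 1) < x (m + 1 + 1)) : Y (x (m + 1)) (x (m + 1 + 1)) ≤ Z (x m) (x (m + 1)) := by
  obtain ⟨δ, hδ, h⟩ := hP.exists_local_min hp hr hx hD m
  have hmono := hx.1.1.2.1 hp.le (show m ≤ m + 1 by lia)
  have := nonneg_of_hasDerivAt_of_le_right (hP.hasDerivAt_middle (hD m) (hD (m + 1)))
    (lt_min hδ (sub_pos.2 hlt)) fun s hs hs' => h s
      (by rw [abs_lt]; constructor <;> linarith [min_le_left δ (x (m + 1 + 1) - x (m + 1))])
      (hmono.trans hs.le) (by linarith [min_le_right δ (x (m + 1 + 1) - x (m + 1))])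
  linarith

/-- A minimizer in the class of monotone sequences is strictly monotone. -/
lemma isActionMin_lt (hP : IsTwistPotential a b ωm ωp H Y Z) (hp : 0 < p) (hr : 2 ≤ r)
    (hx : IsActionMin ωm ωp H p r x) (hD : ∀ n, (x n, x (n + 1)) ∈ genDomain ωm ωp) (n : ℤ) :
    x n < x (n + 1) := by
  have hmono := hx.1.1.2.1 hp.le
  have hp0 : (0 : ℝ) < p := by exact_mod_cast hp
  refine (hmono (show n ≤ n + 1 by lia)).lt_of_ne fun heq => ?_
  -- A plateau at `c = x n` begins at `m + 1` and ends at `l + 1`. The half-equations at its ends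
  -- and the twist give `Z (x m) c ≤ Y c c < Y c (x (l + 2)) ≤ Z c c < Z (x m) c`.
  obtain ⟨m, hm, hmn, hm'⟩ : ∃ m : ℤ, m + 1 ≤ n ∧ x (m + 1) = x n ∧ x m ≠ x n := by
    by_contra! hcon
    have : ∀ i : ℕ, x (n - i) = x n := by
      intro i
      induction i with
      | zero => simp
      | succ i ih =>
        refine hcon (n - (i + 1 : ℕ)) (by push_cast; lia) ?_
        rw [← ih]; congr 1; push_cast; ring
    have h := hx.1.1.1 (n - r)
    rw [this r, sub_add_cancel] at h
    linarith
  obtain ⟨l, hl, hln, hl'⟩ : ∃ l : ℤ, n + 1 ≤ l + 1 ∧ x (l + 1) = x n ∧ x (l + 1 + 1) ≠ x n := by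
    by_contra! hcon
    have : ∀ i : ℕ, x (n + 1 + i) = x n := by
      intro i
      induction i with
      | zero => simpa using heq.symm
      | succ i ih =>
        have := hcon (n + i) (by lia) (by rw [← ih]; congr 1; ring)
        rw [← this]; congr 1; push_cast; ring
    have h := hx.1.1.1 (n + 1)
    rw [this r, ← heq] at h
    linarith
  have hxm : x m < x n := (hmono (show m ≤ n by lia)).lt_of_ne hm'
  have hxl : x n < x (l + 1 + 1) := (hmono (show n ≤ l + 1 + 1 by lia)).lt_of_ne hl'.symm
  have hxm2 : x (m + 1 + 1) = x n := le_antisymm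
    (by rw [heq]; exact hmono (by lia)) (hmn ▸ hmono (show m + 1 ≤ m + 1 + 1 by lia))
  have hxl0 : x l = x n := le_antisymm (hln ▸ hmono (show l ≤ l + 1 by lia)) (hmono (by lia))
  have e1 := hP.snd_le_fst_of_lt hp hr hx hD (m := m) (by rwa [hmn])
  have e2 := hP.fst_le_snd_of_lt hp hr hx hD (m := l) (by rwa [hln])
  have d1 := hD m
  have d2 := hD l
  have d3 := hD (l + 1)
  rw [hmn, hxm2] at e1
  rw [hln, hxl0] at e2
  rw [hmn] at d1
  rw [hln, hxl0] at d2
  rw [hln] at d3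
  linarith [hP.strictMono _ _ _ d2 d3 hxl, hP.strictAnti _ _ _ d1 d2 hxm]

lemma snd_eq_fst (hP : IsTwistPotential a b ωm ωp H Y Z) (hp : 0 < p) (hr : 2 ≤ r)
    (hx : IsActionMin ωm ωp H p r x) (hD : ∀ n, (x n, x (n + 1)) ∈ genDomain ωm ωp) (m : ℤ) :
    Z (x m) (x (m + 1)) = Y (x (m + 1)) (x (m + 1 + 1)) :=
  le_antisymm (hP.snd_le_fst_of_lt hp hr hx hD (hP.isActionMin_lt hp hr hx hD m))
    (hP.fst_le_snd_of_lt hp hr hx hD (hP.isActionMin_lt hp hr hx hD (m + 1)))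

/-- Ordered minimizers which touch coincide. -/
lemma eq_of_touch (hP : IsTwistPotential a b ωm ωp H Y Z) (hp : 0 < p) (hr : 2 ≤ r)
    (hx : IsActionMin ωm ωp H p r x) (hDx : ∀ n, (x n, x (n + 1)) ∈ genDomain ωm ωp)
    (hy : IsActionMin ωm ωp H p r y) (hDy : ∀ n, (y n, y (n + 1)) ∈ genDomain ωm ωp)
    (hle : ∀ n, x n ≤ y n) {m : ℤ} (hm : x m = y m) (n : ℤ) : x n = y n := by
  -- At a contact, a larger previous term lowers `Z` and a larger next term raises `Y`; stationarity
  -- of both sequences permits neither.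
  have key : ∀ m, x (m + 1) = y (m + 1) → x m = y m ∧ x (m + 1 + 1) = y (m + 1 + 1) := by
    intro m hm
    have ex := hP.snd_eq_fst hp hr hx hDx m
    have ey := hP.snd_eq_fst hp hr hy hDy m
    have d1 := hDx m
    have d2 := hDx (m + 1)
    have d3 := hDy m
    have d4 := hDy (m + 1)
    rw [hm] at ex d1 d2
    rcases (hle m).eq_or_lt with h1 | h1 <;> rcases (hle (m + 1 + 1)).eq_or_lt with h2 | h2
    · exact ⟨h1, h2⟩
    · have := hP.strictMono _ _ _ d2 d4 h2
      rw [h1] at ex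
      linarith
    · have := hP.strictAnti _ _ _ d1 d3 h1
      rw [h2] at ex
      linarith
    · linarith [hP.strictMono _ _ _ d2 d4 h2, hP.strictAnti _ _ _ d1 d3 h1]
  rcases le_total m n with h | h
  · induction n, h using Int.leInduction with
    | base => exact hm
    | succ n _ ih =>
      have := (key (n - 1) (by simpa using ih)).2
      simpa using this
  · induction n, h using Int.leInductionDown with
    | base => exact hm
    | pred n _ ih => exact (key (n - 1) (by simpa using ih)).1

end IsTwistPotential

/-! ### The strict convexity inequality for positive `p`. -/

namespace IsTwistPotential

variable {a b ωm ωp : EReal} {H Y Z : ℝ → ℝ → ℝ} {p : ℤ}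

lemma exists_interior_minimizer (hP : IsTwistPotential a b ωm ωp H Y Z) (hp : 0 < p) {r : ℕ}
    (hr : 0 < r) (hlo : ωm < (((p : ℝ) / (r : ℝ) : ℝ) : EReal))
    (hhi : (((p : ℝ) / (r : ℝ) : ℝ) : EReal) < ωp) :
    ∃ x ∈ periodicSeqs p r, (∀ n : ℤ, (x n, x (n + 1)) ∈ genDomain ωm ωp) ∧
      minAction ωm ωp H p r =
        ((∑ n ∈ Finset.range r, H (x (n : ℤ)) (x ((n : ℤ) + 1)) : ℝ) : EReal) := by
  obtain ⟨x, hx, hval⟩ := hP.exists_isActionMin (hlo.trans hhi) hp hr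
    (hP.minAction_ne_top (hlo.trans hhi) hp hr hlo hhi)
  have hD := hP.isActionMin_mem_genDomain hp hr hlo hhi hx
  refine ⟨x, hx.1.1, hD, ?_⟩
  rw [hval, realAction]
  exact congrArg _ (Finset.sum_congr rfl fun n _ => hP.realExtend_eq (hD n))

/-- Maxima and minima of two chains which exchange their endpoints after one period. -/
lemma exists_max_min (hP : IsTwistPotential a b ωm ωp H Y Z) (hω : ωm < ωp) (hp : 0 < p) {r : ℕ}
    (hr : 0 < r) {w u : ℕ → ℝ} (hwu : w r = u 0 + p) (huw : u r = w 0 + p)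
    (hw : ∀ j < r, w j ≤ w (j + 1)) (hu : ∀ j < r, u j ≤ u (j + 1))
    (hwE : ∀ j < r, extend ωm ωp H (w j) (w (j + 1)) ≠ ⊤)
    (huE : ∀ j < r, extend ωm ωp H (u j) (u (j + 1)) ≠ ⊤) :
    ∃ y ∈ admissible ωm ωp H p r, ∃ x ∈ admissible ωm ωp H p r,
      (∀ j ≤ r, y (j : ℤ) = max (w j) (u j)) ∧ (∀ j ≤ r, x (j : ℤ) = min (w j) (u j)) ∧
      realAction ωm ωp H r y + realAction ωm ωp H r x ≤
        ∑ j ∈ Finset.range r, (realExtend ωm ωp H (w j) (w (j + 1)) +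
          realExtend ωm ωp H (u j) (u (j + 1))) ∧
      ((∃ j < r, u j < w j ∧ w (j + 1) < u (j + 1)) →
        realAction ωm ωp H r y + realAction ωm ωp H r x <
        ∑ j ∈ Finset.range r, (realExtend ωm ωp H (w j) (w (j + 1)) +
          realExtend ωm ωp H (u j) (u (j + 1)))) := by
  obtain ⟨y, hy, hyj, hyact⟩ := hP.exists_admissible hp hr (g := fun j => max (w j) (u j))
    (by simp only [hwu, huw, max_add_add_right, max_comm])
    (fun j hj => max_le_max (hw j hj) (hu j hj))
    (fun j hj => (hP.realExtend_max_min hω (hwE j hj) (huE j hj)).1)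
  obtain ⟨x, hx, hxj, hxact⟩ := hP.exists_admissible hp hr (g := fun j => min (w j) (u j))
    (by simp only [hwu, huw, min_add_add_right, min_comm])
    (fun j hj => min_le_min (hw j hj) (hu j hj))
    (fun j hj => (hP.realExtend_max_min hω (hwE j hj) (huE j hj)).2.1)
  refine ⟨y, hy, x, hx, hyj, hxj, ?_, ?_⟩ <;> rw [hyact, hxact, ← Finset.sum_add_distrib]
  · exact Finset.sum_le_sum fun j hj =>
      (hP.realExtend_max_min hω (hwE j (Finset.mem_range.1 hj)) (huE j (Finset.mem_range.1 hj))).2.2.1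
  · rintro ⟨j, hj, h1, h2⟩
    exact Finset.sum_lt_sum (fun j hj => (hP.realExtend_max_min hω
        (hwE j (Finset.mem_range.1 hj)) (huE j (Finset.mem_range.1 hj))).2.2.1)
      ⟨j, Finset.mem_range.2 hj, (hP.realExtend_max_min hω (hwE j hj) (huE j hj)).2.2.2 h1 h2⟩

/-- Here `q = k + 2`: the nested first steps of `x` and `z` exchange ends, and the result is cut
into two chains of length `q`. -/
lemma two_mul_realAction_lt (hP : IsTwistPotential a b ωm ωp H Y Z) (hp : 0 < p) {k : ℕ}
    (hlo : ωm < (((p : ℝ) / ((k + 2 : ℕ) : ℝ) : ℝ) : EReal))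
    (hhi : (((p : ℝ) / ((k + 2 : ℕ) : ℝ) : ℝ) : EReal) < ωp) {x z t : ℤ → ℝ}
    (hx : IsActionMin ωm ωp H p (k + 1) x) (hz : IsActionMin ωm ωp H p (k + 3) z)
    (ht : IsActionMin ωm ωp H p (k + 2) t) (hx0 : x 0 ≤ z 0) (hx1 : z 1 ≤ x 1) :
    2 * realAction ωm ωp H (k + 2) t <
      realAction ωm ωp H (k + 1) x + realAction ωm ωp H (k + 3) z := by
  have hω := hlo.trans hhi
  have hxm := hx.1.1.2.1 hp.le
  have hzm := hz.1.1.2.1 hp.le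
  have hxk : x (k + 1) = x 0 + p := by have := hx.1.1.1 0; push_cast at this; simpa using this
  have hzk : z (k + 3) = z 0 + p := by have := hz.1.1.1 0; push_cast at this; simpa using this
  have hx01 : extend ωm ωp H (x 0) (x 1) ≠ ⊤ := by simpa using hx.1.2 0
  have hz01 : extend ωm ωp H (z 0) (z 1) ≠ ⊤ := by simpa using hz.1.2 0
  obtain ⟨c1, c2, c3, c4⟩ := hP.realExtend_cross hω hx0 hx1 hx01 hz01
  -- The chains are `z 1, …, z 0 + p` and `z 0, x 1, …, x 0 + p, z 1 + p`. Together they use the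
  -- steps of `x` and `z`, with `(x 0, x 1)`, `(z 0, z 1)` replaced by `(x 0, z 1)`, `(z 0, x 1)`.
  let w : ℕ → ℝ := fun j => z (j + 1)
  let u : ℕ → ℝ := fun j => if j = 0 then z 0 else if j = k + 2 then z 1 + p else x j
  have hu0 : u 0 = z 0 := rfl
  have hul : u (k + 2) = z 1 + p := by simp [u]
  have huj : ∀ j < k + 1, u (j + 1) = x (j + 1) := by
    intro j hj
    simp only [u, Nat.add_eq_zero_iff, one_ne_zero, and_false, if_false,
      show ¬ (j + 1 = k + 2) by lia]
    push_cast; rfl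
  have hu1 : u 1 = x 1 := by simpa using huj 0 (by lia)
  have huk : u (k + 1) = x 0 + p := by rw [huj k (by lia), hxk]
  have hw0 : w 0 = z 1 := by simp [w]
  have hwl : w (k + 2) = z 0 + p := by
    rw [← hzk]; simp only [w]; congr 1
  have hcases : ∀ j < k + 2, j = 0 ∨ j = k + 1 ∨ ∃ i < k, j = i + 1 := by
    intro j hj
    rcases j with _ | i
    · exact Or.inl rfl
    · rcases Nat.lt_succ_iff_lt_or_eq.1 (show i < k + 1 by lia) with h | h
      · exact Or.inr (Or.inr ⟨i, h, rfl⟩)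
      · exact Or.inr (Or.inl (by lia))
  have hum : ∀ j < k + 2, u j ≤ u (j + 1) := by
    intro j hj
    rcases hcases j hj with rfl | rfl | ⟨i, hi, rfl⟩
    · rw [hu0, zero_add, hu1]; exact (hzm (show (0 : ℤ) ≤ 1 by lia)).trans hx1
    · rw [huk, hul]; linarith [hzm (show (0 : ℤ) ≤ 1 by lia)]
    · rw [huj i (by lia), huj (i + 1) (by lia)]; exact hxm (by push_cast; lia)
  have huE : ∀ j < k + 2, extend ωm ωp H (u j) (u (j + 1)) ≠ ⊤ := by
    intro j hj
    rcases hcases j hj with rfl | rfl | ⟨i, hi, rfl⟩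
    · rwa [hu0, zero_add, hu1]
    · rwa [huk, hul, hP.extend_add_intCast]
    · rw [huj i (by lia), huj (i + 1) (by lia)]
      have := hx.1.2 (i + 1)
      push_cast; exact this
  have hwE : ∀ j < k + 2, extend ωm ωp H (w j) (w (j + 1)) ≠ ⊤ := fun j _ => by
    simpa [w] using hz.1.2 (j + 1)
  obtain ⟨y, hy, v, hv, hyj, hvj, hle, hlt⟩ := hP.exists_max_min hω hp (r := k + 2) (by lia)
    (w := w) (u := u) (by rw [hwl, hu0]) (by rw [hul, hw0])
    (fun j _ => hzm (by push_cast; lia)) hum hwE huE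
  have hsum : ∑ j ∈ Finset.range (k + 2), (realExtend ωm ωp H (w j) (w (j + 1)) +
      realExtend ωm ωp H (u j) (u (j + 1))) = realAction ωm ωp H (k + 1) x +
      realAction ωm ωp H (k + 3) z - realExtend ωm ωp H (x 0) (x 1)
      - realExtend ωm ωp H (z 0) (z 1) + realExtend ωm ωp H (x 0) (z 1)
      + realExtend ωm ωp H (z 0) (x 1) := by
    have e1 : ∑ j ∈ Finset.range k, realExtend ωm ωp H (u (j + 1)) (u (j + 1 + 1)) =
        ∑ j ∈ Finset.range k, realExtend ωm ωp H (x ((j + 1 : ℕ) : ℤ))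
          (x (((j + 1 : ℕ) : ℤ) + 1)) := by
      refine Finset.sum_congr rfl fun j hj => ?_
      have hj' := Finset.mem_range.1 hj
      rw [huj j (by lia), huj (j + 1) (by lia)]
      push_cast; rfl
    have e2 : ∑ j ∈ Finset.range (k + 2), realExtend ωm ωp H (w j) (w (j + 1)) =
        ∑ j ∈ Finset.range (k + 2), realExtend ωm ωp H (z ((j + 1 : ℕ) : ℤ))
          (z (((j + 1 : ℕ) : ℤ) + 1)) :=
      Finset.sum_congr rfl fun j _ => by simp [w]
    rw [Finset.sum_add_distrib, e2, realAction, realAction, Finset.sum_range_succ' _ (k + 2),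
      Finset.sum_range_succ' _ k, Finset.sum_range_succ (fun j => realExtend ωm ωp H (u j) _),
      Finset.sum_range_succ' _ k, e1, hu0, zero_add, hu1, huk, hul, hP.realExtend_add_intCast]
    simp only [Nat.cast_zero, zero_add]
    ring
  have hty := ht.2 y hy
  have htv := ht.2 v hv
  by_contra! hcon
  -- Failure of strictness forces equality throughout, so `y` and `v` are minimizers and the chains
  -- never cross strictly within a step.
  have hymin : IsActionMin ωm ωp H p (k + 2) y :=
    ⟨hy, fun s hs => le_trans (by linarith) (ht.2 s hs)⟩
  have hvmin : IsActionMin ωm ωp H p (k + 2) v :=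
    ⟨hv, fun s hs => le_trans (by linarith) (ht.2 s hs)⟩
  have hnocross : ∀ j < k + 2, u j < w j → u (j + 1) ≤ w (j + 1) := by
    intro j hj h
    by_contra! h'
    linarith [hlt ⟨j, hj, h, h'⟩]
  have hyD := hP.isActionMin_mem_genDomain hp (by lia) hlo hhi hymin
  have hvD := hP.isActionMin_mem_genDomain hp (by lia) hlo hhi hvmin
  -- The chains start with `u ≤ w` and end with `u ≥ w`; without a strict crossing they must touch.
  obtain ⟨j, hj, hjeq⟩ : ∃ j < k + 2, u j = w j := by
    by_contra! hne
    have hind : ∀ j < k + 2, u j < w j := by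
      intro j
      induction j with
      | zero => exact fun h0 => ((hzm (show (0 : ℤ) ≤ 1 by lia)).trans hw0.ge).lt_of_ne (hne 0 h0)
      | succ j ih => exact fun hj => (hnocross j (by lia) (ih (by lia))).lt_of_ne (hne _ hj)
    have h1 := hnocross (k + 1) (by lia) (hind (k + 1) (by lia))
    have h2 := hind 0 (by lia)
    rw [hul, hwl] at h1
    rw [hu0, hw0] at h2
    linarith
  have heq := hP.eq_of_touch hp (by lia) hvmin hvD hymin hyD
    (periodicSeqs_le (by lia) hv.1 hy.1 fun i hi => by
      rw [hyj i hi.le, hvj i hi.le]; exact min_le_max)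
    (m := j) (by rw [hyj j hj.le, hvj j hj.le, hjeq, min_self, max_self])
  have huw : ∀ i ≤ k + 2, y i = u i ∧ y i = w i := by
    intro i hi
    have := heq i
    rw [hyj i hi, hvj i hi] at this
    rw [hyj i hi]
    have h1 := le_max_left (w i) (u i)
    have h2 := le_max_right (w i) (u i)
    have h3 := min_le_left (w i) (u i)
    have h4 := min_le_right (w i) (u i)
    constructor <;> linarith
  -- Now `u = w = y`. Its first step gives `z 1 < x 1` and its last `x 0 < z 0`, so the initial
  -- exchange was strict after all.
  have hinc := hP.isActionMin_lt hp (by lia) hymin hyD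
  have a0 := huw 0 (by lia)
  have a1 := huw 1 (by lia)
  have ak := huw (k + 1) (by lia)
  have al := huw (k + 2) le_rfl
  have i0 := hinc 0
  have ik := hinc (k + 1)
  push_cast at a0 a1 ak al i0 ik
  rw [show (k : ℤ) + 1 + 1 = k + 2 by ring, ak.1, al.2, huk, hwl] at ik
  rw [a0.2, a1.1, hw0, hu1] at i0
  linarith [c4 (by linarith) i0]

/-- The neighbouring values may be `⊤`, as `p / (q ± 1)` need not lie in the twist interval; the
inequality is then immediate. Otherwise all three have minimizers, and index shifts of minimizers
are minimizers. -/
theorem two_mul_minAction_lt (hP : IsTwistPotential a b ωm ωp H Y Z) (hp : 0 < p) {k : ℕ}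
    (hlo : ωm < (((p : ℝ) / ((k + 2 : ℕ) : ℝ) : ℝ) : EReal))
    (hhi : (((p : ℝ) / ((k + 2 : ℕ) : ℝ) : ℝ) : EReal) < ωp) :
    2 * minAction ωm ωp H p (k + 2) <
      minAction ωm ωp H p (k + 1) + minAction ωm ωp H p (k + 3) := by
  have hω := hlo.trans hhi
  obtain ⟨t, ht, htval⟩ := hP.exists_isActionMin hω hp (r := k + 2) (by lia)
    (hP.minAction_ne_top hω hp (by lia) hlo hhi)
  have h2 : (2 : EReal) * (realAction ωm ωp H (k + 2) t : EReal) =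
      ((2 * realAction ωm ωp H (k + 2) t : ℝ) : EReal) := by
    rw [EReal.coe_mul]; rfl
  rw [htval, h2]
  by_cases h₁ : minAction ωm ωp H p (k + 1) = ⊤
  · rw [h₁, EReal.top_add_of_ne_bot (hP.minAction_ne_bot hω hp (by lia))]
    exact EReal.coe_lt_top _
  by_cases h₃ : minAction ωm ωp H p (k + 3) = ⊤
  · rw [h₃, EReal.add_top_of_ne_bot (hP.minAction_ne_bot hω hp (by lia))]
    exact EReal.coe_lt_top _
  obtain ⟨x, hx, hxval⟩ := hP.exists_isActionMin hω hp (by lia) h₁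
  obtain ⟨z, hz, hzval⟩ := hP.exists_isActionMin hω hp (by lia) h₃
  obtain ⟨n, hn, hn'⟩ := exists_nested hp (by lia) hx.1.1 hz.1.1
  have hx' := hP.isActionMin_shift hx n
  have hz' := hP.isActionMin_shift hz n
  have := hP.two_mul_realAction_lt hp hlo hhi hx' hz' ht (by simpa using hn) hn'
  rw [hxval, hzval, ← EReal.coe_add, EReal.coe_lt_coe_iff]
  linarith [hx'.2 x hx.1, hx.2 _ hx'.1, hz'.2 z hz.1, hz.2 _ hz'.1]

end IsTwistPotential

/-! ### Reflection to negative `p`, and the conclusion. -/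

lemma neg_mem_periodicSeqs {p : ℤ} {r : ℕ} {x : ℤ → ℝ} (hx : x ∈ periodicSeqs p r) :
    (fun n => -x n) ∈ periodicSeqs (-p) r := by
  refine ⟨fun n => ?_, fun hp i j hij => ?_, fun hp i j hij => ?_⟩
  · simp only [hx.1]; push_cast; ring
  · exact neg_le_neg (hx.2.2 (by lia) hij)
  · exact neg_le_neg (hx.2.1 (by lia) hij)

lemma minAction_neg (ωm ωp : EReal) (H : ℝ → ℝ → ℝ) (p : ℤ) (r : ℕ) :
    minAction (-ωp) (-ωm) (fun s s' => H (-s) (-s')) (-p) r = minAction ωm ωp H p r := by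
  have hact : ∀ x : ℤ → ℝ, action (-ωp) (-ωm) (fun s s' => H (-s) (-s')) r x =
      action ωm ωp H r fun n => -x n := fun x =>
    Finset.sum_congr rfl fun n _ => extend_neg _ _
  refine congrArg sInf (Set.Subset.antisymm ?_ ?_)
  · rintro _ ⟨x, hx, rfl⟩
    exact ⟨_, by simpa using neg_mem_periodicSeqs hx, (hact x).symm⟩
  · rintro _ ⟨x, hx, rfl⟩
    exact ⟨_, neg_mem_periodicSeqs hx, by rw [hact]; simp⟩

lemma coe_neg_div_lt_neg_iff {ω : EReal} (p : ℤ) (r : ℕ) :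
    ((((-p : ℤ) : ℝ) / (r : ℝ) : ℝ) : EReal) < -ω ↔ ω < (((p : ℝ) / (r : ℝ) : ℝ) : EReal) := by
  rw [Int.cast_neg, neg_div, EReal.coe_neg, EReal.neg_lt_neg_iff]

lemma neg_lt_coe_neg_div_iff {ω : EReal} (p : ℤ) (r : ℕ) :
    -ω < ((((-p : ℤ) : ℝ) / (r : ℝ) : ℝ) : EReal) ↔ (((p : ℝ) / (r : ℝ) : ℝ) : EReal) < ω := by
  rw [Int.cast_neg, neg_div, EReal.coe_neg, EReal.neg_lt_neg_iff]

end MonotoneTwist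

theorem lemma1 (a b ωm ωp : EReal) (F : ℝ × ℝ → ℝ × ℝ) (H : ℝ → ℝ → ℝ)
    (hF : MonotoneTwist.IsTwistMap a b ωm ωp F)
    (hH : MonotoneTwist.IsGeneratingFunction a b ωm ωp F H)
    (p : ℤ) (q : ℕ) (hq : 0 < q) (hq1 : q ≠ 1) (hpq : IsCoprime p (q : ℤ))
    (hlo : ωm < (((p : ℝ) / (q : ℝ) : ℝ) : EReal))
    (hhi : (((p : ℝ) / (q : ℝ) : ℝ) : EReal) < ωp) :
    (∀ r ∈ ({q - 1, q, q + 1} : Finset ℕ),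
      ωm < (((p : ℝ) / (r : ℝ) : ℝ) : EReal) → (((p : ℝ) / (r : ℝ) : ℝ) : EReal) < ωp →
      ∃ x ∈ MonotoneTwist.periodicSeqs p r,
        (∀ n : ℤ, (x n, x (n + 1)) ∈ MonotoneTwist.genDomain ωm ωp) ∧
        MonotoneTwist.minAction ωm ωp H p r =
          ((∑ n ∈ Finset.range r, H (x (n : ℤ)) (x ((n : ℤ) + 1)) : ℝ) : EReal)) ∧
    MonotoneTwist.minAction ωm ωp H p (q - 1) + MonotoneTwist.minAction ωm ωp H p (q + 1) >
      2 * MonotoneTwist.minAction ωm ωp H p q := by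
  open MonotoneTwist in
  obtain ⟨Y, Z, hP⟩ := hF.exists_isTwistPotential hH
  obtain ⟨k, rfl⟩ := Nat.exists_eq_add_of_le' (show 2 ≤ q by lia)
  -- The only use of coprimality: `0` is coprime to `q` only for `q = 1`.
  have hp0 : p ≠ 0 := by
    rintro rfl
    have := Int.isUnit_iff.1 (isCoprime_zero_left.1 hpq)
    lia
  have hrpos : ∀ r ∈ ({k + 2 - 1, k + 2, k + 2 + 1} : Finset ℕ), 0 < r := by
    intro r hr
    simp only [Finset.mem_insert, Finset.mem_singleton] at hr
    lia
  rcases hp0.lt_or_gt with hp | hp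
  · have hp' : 0 < -p := by lia
    refine ⟨fun r hr h₁ h₂ => ?_, ?_⟩
    · obtain ⟨x, hx, hD, hval⟩ := hP.neg.exists_interior_minimizer hp' (hrpos r hr)
        ((neg_lt_coe_neg_div_iff p r).2 h₂) ((coe_neg_div_lt_neg_iff p r).2 h₁)
      exact ⟨_, by simpa using neg_mem_periodicSeqs hx, fun n => mem_genDomain_neg_iff.1 (hD n),
        by rw [← hval, minAction_neg]⟩
    · have := hP.neg.two_mul_minAction_lt hp' (k := k)
        ((neg_lt_coe_neg_div_iff p _).2 hhi) ((coe_neg_div_lt_neg_iff p _).2 hlo)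
      simp only [minAction_neg] at this
      exact this
  · exact ⟨fun r hr h₁ h₂ => hP.exists_interior_minimizer hp (hrpos r hr) h₁ h₂,
      hP.two_mul_minAction_lt hp hlo hhi⟩
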